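/- Let $K$ be a field containing $\mathbb{R}$ (for example $K=\mathbb{R}$ or $K=\mathbb{C}$), let $I$ be a countable set, and let $A=(a_{ij})_{i,j\in I}$ be a symmetrized Borcherds Cartan matrix: a real symmetric matrix such that $a_{ij}\le 0$ for $i\ne j$, and such that $2a_{ij}/a_{ii}\in\mathbb{Z}$ for all $j\in I$ whenever $a_{ii}>0$. The Borcherds algebra $\mathfrak{g}(A)$ is the Lie algebra over $K$ with generators $e_i,f_i,h_i$ $(i\in I)$ and relations - $[h_i,h_j]=0$, $[h_i,e_j]=a_{ij}e_j$, $[h_i,f_j]=-a_{ij}f_j$, $[e_i,f_j]=\delta_{ij}h_i$ for all $i,j\in I$; - $(\operatorname{ad} e_i)^{1-2a_{ij}/a_{ii}}e_j=0$ and $(\operatorname{ad} f_i)^{1-2a_{ij}/a_{ii}}f_j=0$ for all $i\neq j$ with $a_{ii}>0$; - $[e_i,e_j]=0$ and $[f_i,f_j]=0$ for all $i,j\in I$ with $a_{ij}=0$. Let $\mathfrak{h}$ be the linear span of $\{h_i : i\in I\}$ in $\mathfrak{g}=\mathfrak{g}(A)$. **Theorem.** Assume that $a_{ii}\le 0$ for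 all $i\in I$, put $J=\{j\in I : a_{jj}=0\}$, and assume that, for $i,j\in I$, one has $a_{ij}=0$ if and only if $i,j\in J$. Let $\le$ be any total order on $J$. Then: 1. There are Lie subalgebras $\mathfrak{u}^+$ and $\mathfrak{u}^-$ of $\mathfrak{g}$ that are free Lie algebras, freely generated by the sets $$U^+=\{\operatorname{ad}(e_{j_1})^{\ell_1}\cdots\operatorname{ad}(e_{j_n})^{\ell_n}e_i : n\ge 0,\ j_1<\dots<j_n \text{ in } J,\ \ell_k>0,\ i\in I\setminus J\},$$ $$U^-=\{\operatorname{ad}(f_{j_1})^{\ell_1}\cdots\operatorname{ad}(f_{j_n})^{\ell_n}f_i : n\ge 0,\ j_1<\dots<j_n \text{ in } J,\ \ell_k>0,\ i\in I\setminus J\},$$ respectively. Within each of these two lists, different data $(n,(j_k),(\ell_k),i)$ give different elements of $\mathfrak{g}$. 2. Let $\mathfrak{g}_J$ be the Borcherds algebra associated to the matrix $(a_{ij})_{i,j\in J}$. There is an injective Lie algebra homomorphism $\mathfrak{g}_J\to\mathfrak{g}$ that maps the generators $e_j,f_j,h_j$ of $\mathfrak{g}_J$ to the elements $e_j,f_j,h_j$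 of $\mathfrak{g}$ for all $j\in J$. With $\mathfrak{g}_J$ identified with its image, $\mathfrak{g}$ is the internal direct sum of vector spaces $$\mathfrak{g}=\mathfrak{u}^-\oplus(\mathfrak{g}_J+\mathfrak{h})\oplus\mathfrak{u}^+.$$ -/

import Mathlib

/-- A real matrix `A`, indexed by `I`, is a *symmetrized Borcherds Cartan matrix*. -/
structure IsSymmetrizedBorcherdsCartan {I : Type*} (A : Matrix I I ℝ) : Prop where
  symm : ∀ i j, A i j = A j i
  offDiag_nonpos : ∀ i j, i ≠ j → A i j ≤ 0
  int_of_pos : ∀ i, 0 < A i i → ∀ j, ∃ m : ℤ, 2 * A i j / A i i = (m : ℝ)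

namespace BorcherdsAlg

noncomputable section

/-- The free generator `e i`. -/
abbrev freeE (K : Type*) [Field K] {I : Type*} (i : I) :
    FreeLieAlgebra K (CartanMatrix.Generators I) :=
  FreeLieAlgebra.of K (CartanMatrix.Generators.E i)

/-- The free generator `f i`. -/
abbrev freeF (K : Type*) [Field K] {I : Type*} (i : I) :
    FreeLieAlgebra K (CartanMatrix.Generators I) :=
  FreeLieAlgebra.of K (CartanMatrix.Generators.F i)

/-- The free generator `h i`. -/
abbrev freeH (K : Type*) [Field K] {I : Type*} (i : I) :
    FreeLieAlgebra K (CartanMatrix.Generators I) :=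
  FreeLieAlgebra.of K (CartanMatrix.Generators.H i)

/-- The defining relators of the Borcherds algebra of `A`, as elements of the free Lie algebra on
`e i`, `f i`, `h i`. In the Serre relators the exponent is the natural number `N` that is equal to
`1 - 2 * A i j / A i i` as a real number. -/
inductive IsRelator (K : Type*) [Field K] [Algebra ℝ K] {I : Type*} (A : Matrix I I ℝ) :
    FreeLieAlgebra K (CartanMatrix.Generators I) → Prop
  | hh (i j : I) : IsRelator K A ⁅freeH K i, freeH K j⁆
  | he (i j : I) : IsRelator K A (⁅freeH K i, freeE K j⁆ - algebraMap ℝ K (A i j) • freeE K j)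
  | hf (i j : I) : IsRelator K A (⁅freeH K i, freeF K j⁆ + algebraMap ℝ K (A i j) • freeF K j)
  | ef_same (i : I) : IsRelator K A (⁅freeE K i, freeF K i⁆ - freeH K i)
  | ef_ne (i j : I) (hij : i ≠ j) : IsRelator K A ⁅freeE K i, freeF K j⁆
  | serreE (i j : I) (N : ℕ) (hij : i ≠ j) (hi : 0 < A i i)
      (hN : (N : ℝ) = 1 - 2 * A i j / A i i) :
      IsRelator K A (((LieAlgebra.ad K _ (freeE K i)) ^ N) (freeE K j))
  | serreF (i j : I) (N : ℕ) (hij : i ≠ j) (hi : 0 < A i i)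
      (hN : (N : ℝ) = 1 - 2 * A i j / A i i) :
      IsRelator K A (((LieAlgebra.ad K _ (freeF K i)) ^ N) (freeF K j))
  | ee (i j : I) (hij : A i j = 0) : IsRelator K A ⁅freeE K i, freeE K j⁆
  | ff (i j : I) (hij : A i j = 0) : IsRelator K A ⁅freeF K i, freeF K j⁆

/-- The ideal generated by the defining relators. -/
def relIdeal (K : Type*) [Field K] [Algebra ℝ K] {I : Type*} (A : Matrix I I ℝ) :
    LieIdeal K (FreeLieAlgebra K (CartanMatrix.Generators I)) :=
  LieSubmodule.lieSpan K _ {x | IsRelator K A x}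

end

end BorcherdsAlg

/-- The Borcherds algebra `𝔤(A)` over `K` associated to the matrix `A`. -/
def BorcherdsAlgebra (K : Type*) [Field K] [Algebra ℝ K] {I : Type*} (A : Matrix I I ℝ) : Type _ :=
  FreeLieAlgebra K (CartanMatrix.Generators I) ⧸ BorcherdsAlg.relIdeal K A

namespace BorcherdsAlg

noncomputable section

instance instLieRing (K : Type*) [Field K] [Algebra ℝ K] {I : Type*} (A : Matrix I I ℝ) :
    LieRing (BorcherdsAlgebra K A) :=
  inferInstanceAs (LieRing (FreeLieAlgebra K (CartanMatrix.Generators I) ⧸ relIdeal K A))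

instance instLieAlgebra (K : Type*) [Field K] [Algebra ℝ K] {I : Type*} (A : Matrix I I ℝ) :
    LieAlgebra K (BorcherdsAlgebra K A) :=
  inferInstanceAs (LieAlgebra K (FreeLieAlgebra K (CartanMatrix.Generators I) ⧸ relIdeal K A))

/-- The quotient map from the free Lie algebra onto `𝔤(A)`. -/
def mk (K : Type*) [Field K] [Algebra ℝ K] {I : Type*} (A : Matrix I I ℝ) :
    FreeLieAlgebra K (CartanMatrix.Generators I) →ₗ⁅K⁆ BorcherdsAlgebra K A where
  toLinearMap := (LieSubmodule.Quotient.mk' (relIdeal K A)).toLinearMap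
  map_lie' := rfl

/-- The generator `e i` of `𝔤(A)`. -/
def e (K : Type*) [Field K] [Algebra ℝ K] {I : Type*} (A : Matrix I I ℝ) (i : I) :
    BorcherdsAlgebra K A :=
  mk K A (freeE K i)

/-- The generator `f i` of `𝔤(A)`. -/
def f (K : Type*) [Field K] [Algebra ℝ K] {I : Type*} (A : Matrix I I ℝ) (i : I) :
    BorcherdsAlgebra K A :=
  mk K A (freeF K i)

/-- The generator `h i` of `𝔤(A)`. -/
def h (K : Type*) [Field K] [Algebra ℝ K] {I : Type*} (A : Matrix I I ℝ) (i : I) :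
    BorcherdsAlgebra K A :=
  mk K A (freeH K i)

/-- The subspace `𝔥` of `𝔤(A)` spanned by the `h i`. -/
def cartan (K : Type*) [Field K] [Algebra ℝ K] {I : Type*} (A : Matrix I I ℝ) :
    Submodule K (BorcherdsAlgebra K A) :=
  Submodule.span K (Set.range (h K A))

/-- The set `J` of the indices `j` with `A j j = 0`. -/
def zeroSet {I : Type*} (A : Matrix I I ℝ) : Set I := {j | A j j = 0}

/-- The submatrix of `A` with rows and columns in `J`. -/
def zeroBlock {I : Type*} (A : Matrix I I ℝ) : Matrix (zeroSet A) (zeroSet A) ℝ :=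
  A.submatrix Subtype.val Subtype.val

/-- The data `n ≥ 0`, `j₁ < ⋯ < jₙ` in `J`, `ℓ₁, …, ℓₙ > 0` and `i ∈ I - J`. -/
structure UIndex {I : Type*} (A : Matrix I I ℝ) [LinearOrder (zeroSet A)] where
  n : ℕ
  j : Fin n → zeroSet A
  j_strictMono : StrictMono j
  l : Fin n → ℕ
  l_pos : ∀ k, 0 < l k
  i : I
  i_notMem : i ∉ zeroSet A

/-- `ad(x j₁) ^ ℓ₁ ⋯ ad(x jₙ) ^ ℓₙ (x i)`, for a family `x` of elements of a Lie algebra. -/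
def adMonomial (K : Type*) [Field K] {I : Type*} {A : Matrix I I ℝ} [LinearOrder (zeroSet A)]
    {L : Type*} [LieRing L] [LieAlgebra K L] (x : I → L) (t : UIndex A) : L :=
  (List.ofFn fun k : Fin t.n => (LieAlgebra.ad K L (x (t.j k))) ^ t.l k).prod (x t.i)

/-- The set `U⁺`. -/
def UPlus (K : Type*) [Field K] [Algebra ℝ K] {I : Type*} (A : Matrix I I ℝ)
    [LinearOrder (zeroSet A)] : Set (BorcherdsAlgebra K A) :=
  Set.range (adMonomial K (e K A) : UIndex A → BorcherdsAlgebra K A)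

/-- The set `U⁻`. -/
def UMinus (K : Type*) [Field K] [Algebra ℝ K] {I : Type*} (A : Matrix I I ℝ)
    [LinearOrder (zeroSet A)] : Set (BorcherdsAlgebra K A) :=
  Set.range (adMonomial K (f K A) : UIndex A → BorcherdsAlgebra K A)

/-- The Lie subalgebra `u` is free with free generating set `U`: the inclusion of `U` extends to an
isomorphism from the free Lie algebra on `U` onto `u`. -/
def IsFreelyGeneratedBy {K : Type*} [Field K] {L : Type*} [LieRing L] [LieAlgebra K L]
    (u : LieSubalgebra K L) (U : Set L) : Prop :=
  ∃ φ : FreeLieAlgebra K U ≃ₗ⁅K⁆ u, ∀ x : U, (φ (FreeLieAlgebra.of K x) : L) = x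

end

end BorcherdsAlg

-- Since no diagonal entry is positive, there are no Serre relations. The `e j` with `j ∈ J`
-- commute, so the monomials `ad(e j₁)^ℓ₁ ⋯ e i` are indexed by a multiset in `J` and an index `i ∉
-- J`; write `W` for this index set and `F` for the free Lie algebra on it. On `F` the bracket with
-- `e j` should be the derivation that inserts `j` into the multiset of each generator.
--
-- Spanning (`total_eq_top`): the images of `F` on the two sides, together with the `h i` and the `e
-- j`, `f j` for `j ∈ J`, span a subspace stable under bracketing with all generators. The decisive
-- case is `y_lie_mem`: for `i ∉ J`, `ad (f i)` commutes with every `ad (e j)`, `j ∈ J`, so it sends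
-- a monomial into the span of the `h k` and the `e j`.
--
-- Independence (`combination_eq_zero`): for every `c : I → K` there is a Verma module on `NegAlg`,
-- the associative algebra whose generators commute exactly as the `f i` are required to. Evaluation
-- at its highest weight vector kills the positive part, multiplies by `c i` for `h i`, and sends
-- the negative part into `NegAlg`. In turn `NegAlg` acts on `F × K`, with `j ∈ J` acting by
-- insertion and `i ∉ J` by the adjoint action, extended so that `x ∈ F` sends `(0, 1)` to `(euler
-- x, 0)`. The Euler derivation is injective in characteristic zero, so `F` embeds in the negative
-- part without any appeal to Poincaré–Birkhoff–Witt. Varying `c` separates the `h i`, and the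
-- Chevalley involution carries the result to the positive part. The `f j` with `j ∈ J`, invisible
-- to this test, are recovered by bracketing with `e j`.

attribute [local instance 100] LieRing.ofAssociativeRing

/-! ### Derivations of free Lie algebras, by way of dual numbers -/

/-- The Lie algebra `L ⊗ K[ε]` of dual numbers over `L`, on the vector space `L × L`. -/
@[ext] structure DualLie (L : Type*) where
  /-- The value. -/
  val : L
  /-- The coefficient of `ε`. -/
  eps : L

namespace DualLie

variable {K L : Type*} [CommRing K] [LieRing L] [LieAlgebra K L]

/-- As a set, the dual numbers are pairs. -/
def toProd : DualLie L ≃ L × L where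
  toFun x := (x.val, x.eps)
  invFun x := ⟨x.1, x.2⟩

instance : AddCommGroup (DualLie L) := toProd.addCommGroup

instance : Module K (DualLie L) := toProd.module K

instance : Bracket (DualLie L) (DualLie L) :=
  ⟨fun x y => ⟨⁅x.val, y.val⁆, ⁅x.val, y.eps⁆ + ⁅x.eps, y.val⁆⟩⟩

@[simp] theorem val_zero : (0 : DualLie L).val = 0 := rfl
@[simp] theorem eps_zero : (0 : DualLie L).eps = 0 := rfl
@[simp] theorem val_add (x y : DualLie L) : (x + y).val = x.val + y.val := rfl
@[simp] theorem eps_add (x y : DualLie L) : (x + y).eps = x.eps + y.eps := rfl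
@[simp] theorem val_smul (t : K) (x : DualLie L) : (t • x).val = t • x.val := rfl
@[simp] theorem eps_smul (t : K) (x : DualLie L) : (t • x).eps = t • x.eps := rfl
@[simp] theorem val_lie (x y : DualLie L) : ⁅x, y⁆.val = ⁅x.val, y.val⁆ := rfl
@[simp] theorem eps_lie (x y : DualLie L) : ⁅x, y⁆.eps = ⁅x.val, y.eps⁆ + ⁅x.eps, y.val⁆ := rfl

instance : LieRing (DualLie L) where
  add_lie x y z := by ext <;> simp; abel
  lie_add x y z := by ext <;> simp; abel
  lie_self x := by
    ext
    · simp
    · rw [eps_lie, ← lie_skew x.val x.eps]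
      exact neg_add_cancel _
  leibniz_lie x y z := by
    ext
    · simp
    · simp only [eps_lie, val_lie, eps_add, lie_add, add_lie]
      rw [leibniz_lie x.val y.val z.eps, leibniz_lie x.val y.eps z.val,
        leibniz_lie x.eps y.val z.val]
      abel

instance : LieAlgebra K (DualLie L) where
  lie_smul t x y := by ext <;> simp

/-- The projection onto the value. -/
def valHom : DualLie L →ₗ⁅K⁆ L where
  toFun := val
  map_add' _ _ := rfl
  map_smul' _ _ := rfl
  map_lie' := rfl

end DualLie

namespace FreeLieAlgebra

variable {K X : Type*} [CommRing K]

/-- The Lie subalgebra generated by the free generators is everything. -/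
theorem mem_of_of_mem (S : LieSubalgebra K (FreeLieAlgebra K X)) (h : ∀ x, of K x ∈ S)
    (y : FreeLieAlgebra K X) : y ∈ S := by
  have key : S.incl.comp (lift K fun x => (⟨of K x, h x⟩ : S)) = LieHom.id := by
    ext x; simp
  have := LieHom.congr_fun key y
  simp only [LieHom.comp_apply, LieHom.id_apply] at this
  rw [← this]
  exact (lift K (fun x => (⟨of K x, h x⟩ : S)) y).2

/-- The homomorphism to the dual numbers that defines `derivation g`. -/
noncomputable def dualLift (g : X → FreeLieAlgebra K X) :
    FreeLieAlgebra K X →ₗ⁅K⁆ DualLie (FreeLieAlgebra K X) :=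
  lift K fun x => ⟨of K x, g x⟩

theorem val_dualLift (g : X → FreeLieAlgebra K X) (y : FreeLieAlgebra K X) :
    (dualLift g y).val = y := by
  have key : (DualLie.valHom (K := K)).comp (dualLift g) = LieHom.id := by
    ext x
    change (dualLift g (of K x)).val = of K x
    simp [dualLift]
  exact LieHom.congr_fun key y

/-- The linear map underlying the derivation that maps each free generator `x` to `g x`. -/
noncomputable def derivation (g : X → FreeLieAlgebra K X) :
    FreeLieAlgebra K X →ₗ[K] FreeLieAlgebra K X where
  toFun y := (dualLift g y).eps
  map_add' _ _ := by simp
  map_smul' _ _ := by simp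

@[simp] theorem derivation_of (g : X → FreeLieAlgebra K X) (x : X) :
    derivation g (of K x) = g x := by
  simp [derivation, dualLift]

/-- This is the `ε`-coefficient of the bracket of dual numbers; the other factor in each term is the
argument itself because the value component of `dualLift g` is the identity. -/
theorem derivation_lie (g : X → FreeLieAlgebra K X) (y z : FreeLieAlgebra K X) :
    derivation g ⁅y, z⁆ = ⁅y, derivation g z⁆ + ⁅derivation g y, z⁆ := by
  simp [derivation, val_dualLift]

/-- If the derivations given by `g` and `g'` commute on generators, then they commute. -/
theorem derivation_comm (g g' : X → FreeLieAlgebra K X)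
    (h : ∀ x, derivation g (g' x) = derivation g' (g x)) (y : FreeLieAlgebra K X) :
    derivation g (derivation g' y) = derivation g' (derivation g y) := by
  refine mem_of_of_mem (K := K) (X := X)
    { LinearMap.eqLocus (derivation g ∘ₗ derivation g') (derivation g' ∘ₗ derivation g) with
      lie_mem' := ?_ } (fun x => ?_) y
  · intro a b ha hb
    simp only [AddSubsemigroup.mem_carrier, AddSubmonoid.mem_toSubsemigroup,
      Submodule.mem_toAddSubmonoid, LinearMap.mem_eqLocus, LinearMap.comp_apply] at ha hb ⊢
    simp only [derivation_lie, map_add, ha, hb]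
    abel
  · change derivation g (derivation g' (of K x)) = derivation g' (derivation g (of K x))
    simpa using h x

/-- The Euler derivation, which multiplies a bracket of `n` generators by `n`. -/
noncomputable def euler (K X : Type*) [CommRing K] : FreeLieAlgebra K X →ₗ[K] FreeLieAlgebra K X :=
  derivation (of K)

/-- Free generators have eigenvalue `1` and eigenvalues add under brackets, so the eigenspaces for
positive integers span. In characteristic zero these eigenvalues are nonzero, and independence of
eigenspaces leaves nothing for the eigenvalue `0`. -/
theorem euler_injective (K X : Type*) [Field K] [CharZero K] :
    Function.Injective (euler K X) := by
  have htop : (⨆ n : ℕ, Module.End.eigenspace (euler K X) ((n + 1 : ℕ) : K)) = ⊤ := by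
    rw [eq_top_iff]
    rintro y -
    refine mem_of_of_mem (K := K) (X := X)
      { (⨆ n : ℕ, Module.End.eigenspace (euler K X) ((n + 1 : ℕ) : K)) with
        lie_mem' := ?_ } (fun x => ?_) y
    · intro a b ha hb
      change a ∈ (⨆ n : ℕ, Module.End.eigenspace (euler K X) ((n + 1 : ℕ) : K)) at ha
      change b ∈ (⨆ n : ℕ, Module.End.eigenspace (euler K X) ((n + 1 : ℕ) : K)) at hb
      change ⁅a, b⁆ ∈ (⨆ n : ℕ, Module.End.eigenspace (euler K X) ((n + 1 : ℕ) : K))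
      induction ha using Submodule.iSup_induction' with
      | zero => simp
      | add u v _ _ hu hv => rw [add_lie]; exact add_mem hu hv
      | mem n u hu =>
        induction hb using Submodule.iSup_induction' with
        | zero => simp
        | add v w _ _ hv hw => rw [lie_add]; exact add_mem hv hw
        | mem m v hv =>
          -- The index `n` stands for the eigenvalue `n + 1`, and `(n + 1) + (m + 1) = (n + m + 1) +
          -- 1`.
          refine Submodule.mem_iSup_of_mem (n + m + 1) ?_
          rw [Module.End.mem_eigenspace_iff] at hu hv ⊢
          rw [euler] at hu hv ⊢
          rw [derivation_lie, hu, hv, lie_smul, smul_lie, ← add_smul]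
          congr 1
          push_cast
          ring
    · refine Submodule.mem_iSup_of_mem (p := fun n : ℕ =>
        Module.End.eigenspace (euler K X) ((n + 1 : ℕ) : K)) 0 ?_
      rw [Module.End.mem_eigenspace_iff]
      simp [euler]
  rw [← LinearMap.ker_eq_bot, ← Module.End.eigenspace_zero]
  have hd := (Module.End.eigenspaces_iSupIndep (euler K X)) 0
  rw [← disjoint_top, ← htop]
  refine hd.mono_right (iSup_le fun n => ?_)
  exact le_iSup₂_of_le ((n + 1 : ℕ) : K) (by exact_mod_cast Nat.succ_ne_zero n) le_rfl

end FreeLieAlgebra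

/-! ### The universal property of the Borcherds algebra and the Chevalley involution -/

namespace BorcherdsAlg

noncomputable section

variable {K : Type*} [Field K] [Algebra ℝ K] {I : Type*} {A : Matrix I I ℝ}
variable {L : Type*} [LieRing L] [LieAlgebra K L]

/-- The families `x`, `y`, `z` satisfy the relations of the `e i`, `f i`, `h i`, apart from the Serre
relations. -/
structure IsChevalley (K : Type*) [Field K] [Algebra ℝ K] {I : Type*} (A : Matrix I I ℝ)
    {L : Type*} [LieRing L] [LieAlgebra K L] (x y z : I → L) : Prop where
  hh : ∀ i j, ⁅z i, z j⁆ = 0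
  he : ∀ i j, ⁅z i, x j⁆ = algebraMap ℝ K (A i j) • x j
  hf : ∀ i j, ⁅z i, y j⁆ = -(algebraMap ℝ K (A i j) • y j)
  ef_same : ∀ i, ⁅x i, y i⁆ = z i
  ef_ne : ∀ i j, i ≠ j → ⁅x i, y j⁆ = 0
  ee : ∀ i j, A i j = 0 → ⁅x i, x j⁆ = 0
  ff : ∀ i j, A i j = 0 → ⁅y i, y j⁆ = 0

/-- The image of a generator, for a choice of images of the `e i`, `f i`, `h i`. -/
def genMap (x y z : I → L) : CartanMatrix.Generators I → L
  | .E i => x i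
  | .F i => y i
  | .H i => z i

/-- The homomorphism from the Borcherds algebra with given values on the generators, if no diagonal
entry is positive. -/
def lift (hdiag : ∀ i, A i i ≤ 0) {x y z : I → L} (H : IsChevalley K A x y z) :
    BorcherdsAlgebra K A →ₗ⁅K⁆ L :=
  have hker : (relIdeal K A).toSubmodule ≤
      LinearMap.ker (FreeLieAlgebra.lift K (genMap x y z)).toLinearMap := by
    have : relIdeal K A ≤ (FreeLieAlgebra.lift K (genMap x y z)).ker := by
      refine LieSubmodule.lieSpan_le.2 ?_
      intro w hw
      rw [SetLike.mem_coe, LieHom.mem_ker]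
      cases hw with
      | hh i j => simp [genMap, H.hh]
      | he i j => simp [genMap, H.he]
      | hf i j => simp [genMap, H.hf]
      | ef_same i => simp [genMap, H.ef_same]
      | ef_ne i j hij => simp [genMap, H.ef_ne i j hij]
      | serreE i j N hij hi hN => exact absurd hi (not_lt.2 (hdiag i))
      | serreF i j N hij hi hN => exact absurd hi (not_lt.2 (hdiag i))
      | ee i j hij => simp [genMap, H.ee i j hij]
      | ff i j hij => simp [genMap, H.ff i j hij]
    intro w hw
    exact this hw
  { (relIdeal K A).toSubmodule.liftQ _ hker with
    map_lie' := by
      rintro ⟨a⟩ ⟨b⟩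
      exact LieHom.map_lie (FreeLieAlgebra.lift K (genMap x y z)) a b }

theorem lift_mk (hdiag : ∀ i, A i i ≤ 0) {x y z : I → L} (H : IsChevalley K A x y z)
    (w : FreeLieAlgebra K (CartanMatrix.Generators I)) :
    lift hdiag H (mk K A w) = FreeLieAlgebra.lift K (genMap x y z) w := rfl

@[simp] theorem lift_e (hdiag : ∀ i, A i i ≤ 0) {x y z : I → L} (H : IsChevalley K A x y z) (i : I) :
    lift hdiag H (e K A i) = x i := by
  simp [e, lift_mk, genMap]

@[simp] theorem lift_f (hdiag : ∀ i, A i i ≤ 0) {x y z : I → L} (H : IsChevalley K A x y z) (i : I) :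
    lift hdiag H (f K A i) = y i := by
  simp [f, lift_mk, genMap]

@[simp] theorem lift_h (hdiag : ∀ i, A i i ≤ 0) {x y z : I → L} (H : IsChevalley K A x y z) (i : I) :
    lift hdiag H (h K A i) = z i := by
  simp [h, lift_mk, genMap]

theorem mk_surjective : Function.Surjective (mk K A) :=
  LieSubmodule.Quotient.surjective_mk' _

theorem mk_eq_zero {w : FreeLieAlgebra K (CartanMatrix.Generators I)} (hw : IsRelator K A w) :
    mk K A w = 0 :=
  (LieSubmodule.Quotient.mk_eq_zero (N := relIdeal K A)).2 (LieSubmodule.subset_lieSpan hw)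

variable (K A) in
theorem isChevalley : IsChevalley K A (e K A) (f K A) (h K A) where
  hh i j := by simpa [e, f, h] using mk_eq_zero (K := K) (A := A) (.hh i j)
  he i j := by simpa [e, f, h, sub_eq_zero] using mk_eq_zero (K := K) (A := A) (.he i j)
  hf i j := by
    have := mk_eq_zero (K := K) (A := A) (.hf i j)
    rw [map_add, map_smul, LieHom.map_lie] at this
    exact eq_neg_of_add_eq_zero_left this
  ef_same i := by simpa [e, f, h, sub_eq_zero] using mk_eq_zero (K := K) (A := A) (.ef_same i)
  ef_ne i j hij := by simpa [e, f, h] using mk_eq_zero (K := K) (A := A) (.ef_ne i j hij)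
  ee i j hij := by simpa [e, f, h] using mk_eq_zero (K := K) (A := A) (.ee i j hij)
  ff i j hij := by simpa [e, f, h] using mk_eq_zero (K := K) (A := A) (.ff i j hij)

/-- A Lie subalgebra that contains the generators is everything. -/
theorem mem_of_gens_mem (S : LieSubalgebra K (BorcherdsAlgebra K A)) (he : ∀ i, e K A i ∈ S)
    (hf : ∀ i, f K A i ∈ S) (hh : ∀ i, h K A i ∈ S) (x : BorcherdsAlgebra K A) : x ∈ S := by
  obtain ⟨w, rfl⟩ := mk_surjective x
  refine FreeLieAlgebra.mem_of_of_mem (S.comap (mk K A)) (fun g => ?_) w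
  cases g with
  | E i => exact he i
  | F i => exact hf i
  | H i => exact hh i

/-- A subspace that contains the generators and is stable under bracketing with them is
everything. -/
theorem mem_of_stable (S : Submodule K (BorcherdsAlgebra K A)) (he : ∀ i, e K A i ∈ S)
    (hf : ∀ i, f K A i ∈ S) (hh : ∀ i, h K A i ∈ S)
    (he' : ∀ i, ∀ x ∈ S, ⁅e K A i, x⁆ ∈ S) (hf' : ∀ i, ∀ x ∈ S, ⁅f K A i, x⁆ ∈ S)
    (hh' : ∀ i, ∀ x ∈ S, ⁅h K A i, x⁆ ∈ S) (x : BorcherdsAlgebra K A) : x ∈ S := by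
  -- The elements whose bracket preserves `S` form a subalgebra containing the generators, hence
  -- everything. So `S` is itself a subalgebra containing the generators.
  let N : LieSubalgebra K (BorcherdsAlgebra K A) :=
    { carrier := {a | ∀ x ∈ S, ⁅a, x⁆ ∈ S}
      add_mem' := fun {a b} ha hb x hx => by rw [add_lie]; exact add_mem (ha x hx) (hb x hx)
      zero_mem' := fun x _ => by rw [zero_lie]; exact zero_mem _
      smul_mem' := fun t a ha x hx => by rw [smul_lie]; exact S.smul_mem t (ha x hx)
      lie_mem' := fun {a b} ha hb x hx => by
        rw [lie_lie]; exact sub_mem (ha _ (hb x hx)) (hb _ (ha x hx)) }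
  have hN : ∀ a, a ∈ N := mem_of_gens_mem N he' hf' hh'
  exact mem_of_gens_mem { S with lie_mem' := fun {a b} _ hb => hN a b hb } he hf hh x

/-- The sign on `z` is forced by `⁅y i, x i⁆ = -⁅x i, y i⁆`. Through this symmetry, statements about
one half apply to the other. -/
theorem IsChevalley.swap {x y z : I → L} (H : IsChevalley K A x y z) :
    IsChevalley K A y x (fun i => -z i) where
  hh i j := by simp [H.hh]
  he i j := by simp [H.hf]
  hf i j := by simp [H.he]
  ef_same i := by rw [← lie_skew, H.ef_same]
  ef_ne i j hij := by rw [← lie_skew, H.ef_ne j i hij.symm, neg_zero]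
  ee := H.ff
  ff := H.ee

variable (K) in
/-- The involution that interchanges the `e i` and the `f i`. -/
def chevalleyInvolution (hdiag : ∀ i, A i i ≤ 0) :
    BorcherdsAlgebra K A →ₗ⁅K⁆ BorcherdsAlgebra K A :=
  lift hdiag ((isChevalley K A).swap)

theorem chevalleyInvolution_involutive (hdiag : ∀ i, A i i ≤ 0)
    (x : BorcherdsAlgebra K A) :
    chevalleyInvolution K hdiag (chevalleyInvolution K hdiag x) = x := by
  let ω := chevalleyInvolution K hdiag
  refine mem_of_gens_mem
    { LinearMap.eqLocus (ω.toLinearMap ∘ₗ ω.toLinearMap) LinearMap.id with lie_mem' := ?_ }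
    (fun i => ?_) (fun i => ?_) (fun i => ?_) x
  · intro a b ha hb
    change ω (ω a) = a at ha
    change ω (ω b) = b at hb
    change ω (ω ⁅a, b⁆) = ⁅a, b⁆
    rw [LieHom.map_lie, LieHom.map_lie, ha, hb]
  · change ω (ω (e K A i)) = e K A i
    simp [ω, chevalleyInvolution]
  · change ω (ω (f K A i)) = f K A i
    simp [ω, chevalleyInvolution]
  · change ω (ω (h K A i)) = h K A i
    simp [ω, chevalleyInvolution]

end

end BorcherdsAlg

/-! ### Verma modules, realized on `NegAlg` by triangular matrices -/

namespace BorcherdsAlg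

noncomputable section

variable {K : Type*} [Field K] {I : Type*} {A : Matrix I I ℝ}

/-- The relations of the enveloping algebra of the negative part. -/
inductive CommRel (K : Type*) [Field K] {I : Type*} (A : Matrix I I ℝ) :
    FreeAlgebra K I → FreeAlgebra K I → Prop
  | comm (i j : I) (hij : A i j = 0) :
      CommRel K A (FreeAlgebra.ι K i * FreeAlgebra.ι K j) (FreeAlgebra.ι K j * FreeAlgebra.ι K i)

/-- The algebra with generators indexed by `I`, such that the generators `i` and `j` commute if
`A i j = 0`. -/
def NegAlg (K : Type*) [Field K] {I : Type*} (A : Matrix I I ℝ) : Type _ :=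
  RingQuot (CommRel K A)

namespace NegAlg

instance : Ring (NegAlg K A) := inferInstanceAs (Ring (RingQuot (CommRel K A)))

instance : Algebra K (NegAlg K A) := inferInstanceAs (Algebra K (RingQuot (CommRel K A)))

/-- The quotient map from the free algebra. -/
def mkHom (K : Type*) [Field K] {I : Type*} (A : Matrix I I ℝ) : FreeAlgebra K I →ₐ[K] NegAlg K A :=
  RingQuot.mkAlgHom K (CommRel K A)

/-- The generator with index `i`. -/
def gen (K : Type*) [Field K] {I : Type*} (A : Matrix I I ℝ) (i : I) : NegAlg K A :=
  mkHom K A (FreeAlgebra.ι K i)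

theorem gen_comm {i j : I} (hij : A i j = 0) : gen K A i * gen K A j = gen K A j * gen K A i := by
  simp only [gen, ← map_mul]
  exact RingQuot.mkAlgHom_rel K (CommRel.comm i j hij)

/-- The universal property. -/
def lift {B : Type*} [Ring B] [Algebra K B] (b : I → B)
    (hb : ∀ i j, A i j = 0 → b i * b j = b j * b i) : NegAlg K A →ₐ[K] B :=
  RingQuot.liftAlgHom K ⟨FreeAlgebra.lift K b, by
    rintro _ _ ⟨i, j, hij⟩
    simpa using hb i j hij⟩

theorem lift_mkHom {B : Type*} [Ring B] [Algebra K B] (b : I → B)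
    (hb : ∀ i j, A i j = 0 → b i * b j = b j * b i) (v : FreeAlgebra K I) :
    lift b hb (mkHom K A v) = FreeAlgebra.lift K b v :=
  RingQuot.liftAlgHom_mkAlgHom_apply K _ _ _

@[simp] theorem lift_gen {B : Type*} [Ring B] [Algebra K B] (b : I → B)
    (hb : ∀ i j, A i j = 0 → b i * b j = b j * b i) (i : I) : lift b hb (gen K A i) = b i := by
  simp [gen, lift_mkHom]

/-- A subspace that contains `1` and is stable under left multiplication by the generators is
everything. -/
theorem mem_of_stable (S : Submodule K (NegAlg K A)) (h1 : 1 ∈ S)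
    (hS : ∀ i, ∀ w ∈ S, gen K A i * w ∈ S) (w : NegAlg K A) : w ∈ S := by
  suffices key : ∀ v : FreeAlgebra K I, ∀ w ∈ S, mkHom K A v * w ∈ S by
    obtain ⟨v, rfl⟩ : ∃ v, mkHom K A v = w := RingQuot.mkAlgHom_surjective K (CommRel K A) w
    simpa using key v 1 h1
  intro v
  induction v using FreeAlgebra.induction with
  | grade0 r =>
    intro w hw
    rw [AlgHom.commutes, ← Algebra.smul_def]
    exact S.smul_mem r hw
  | grade1 i => exact hS i
  | mul a b ha hb =>
    intro w hw
    rw [map_mul, mul_assoc]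
    exact ha _ (hb _ hw)
  | add a b ha hb =>
    intro w hw
    rw [map_add, add_mul]
    exact add_mem (ha _ hw) (hb _ hw)

/-- The operator `f i` on the Verma modules. -/
def opF (K : Type*) [Field K] {I : Type*} (A : Matrix I I ℝ) (i : I) : Module.End K (NegAlg K A) :=
  Algebra.lmul K (NegAlg K A) (gen K A i)

@[simp] theorem opF_apply (i : I) (w : NegAlg K A) : opF K A i w = gen K A i * w := rfl

/-- An operator that kills `1` and commutes with left multiplication by the generators is zero. -/
theorem eq_zero_of_lie_opF (X : Module.End K (NegAlg K A)) (h1 : X 1 = 0)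
    (hX : ∀ i, ⁅X, opF K A i⁆ = 0) : X = 0 := by
  ext w
  refine mem_of_stable (LinearMap.ker X) h1 (fun i w hw => ?_) w
  have := LinearMap.congr_fun (hX i) w
  rw [LinearMap.mem_ker] at hw ⊢
  simpa [Ring.lie_def, hw] using this

theorem lie_smul_end (X Y : Module.End K (NegAlg K A)) (t : K) : ⁅X, t • Y⁆ = t • ⁅X, Y⁆ :=
  lie_smul t X Y

variable [Algebra ℝ K]

open Classical in
/-- The matrix that describes how multiplication by the generator `j` interacts with the operators
`e i` and `h i` of the Verma modules. -/
def vermaMatrix (K : Type*) [Field K] [Algebra ℝ K] {I : Type*} (A : Matrix I I ℝ) (i j : I) :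
    Matrix (Fin 3) (Fin 3) (NegAlg K A) :=
  -- For a product `w` of generators, the matrix product has `w` on the diagonal. Entry `(1, 2)` is
  -- `w` times minus the sum of the `A i j` over its factors. Entry `(0, 1)` deletes one occurrence
  -- of the generator `i`, summed over all occurrences, and `(0, 2)` weights each deletion by minus
  -- the sum of the `A i j` over the factors to its right.
  !![gen K A j, if i = j then 1 else 0, 0;
    0, gen K A j, -(algebraMap ℝ K (A i j) • gen K A j);
    0, 0, gen K A j]

/-- Commutativity of the generators `j` and `k` settles all entries but the corner `(0, 2)`. There a
nonzero term needs `i = j` or `i = k`, and it then carries the factor `A j k` or `A k j`, both zero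
by symmetry. -/
theorem vermaMatrix_comm (hA : ∀ i j, A i j = A j i) (i j k : I) (hjk : A j k = 0) :
    vermaMatrix K A i j * vermaMatrix K A i k = vermaMatrix K A i k * vermaMatrix K A i j := by
  have hkj : A k j = 0 := by rw [hA, hjk]
  have hc := gen_comm (K := K) hjk
  ext r s
  fin_cases r <;> fin_cases s <;>
    simp [vermaMatrix, Matrix.mul_apply, Fin.sum_univ_three, hc, -algebraMap_smul]
  · split_ifs <;> simp_all
  · split_ifs <;> simp_all
  · rw [add_comm]

/-- The homomorphism to matrices given by `vermaMatrix`. -/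
def vermaHom (K : Type*) [Field K] [Algebra ℝ K] {I : Type*} {A : Matrix I I ℝ}
    (hA : ∀ i j, A i j = A j i) (i : I) :
    NegAlg K A →ₐ[K] Matrix (Fin 3) (Fin 3) (NegAlg K A) :=
  lift (vermaMatrix K A i) (vermaMatrix_comm hA i)

variable (hA : ∀ i j, A i j = A j i) (c : I → K)

/-- The bottom row is what closes the recursion for `opH` in `opH_gen_mul`. -/
theorem vermaHom_two_two (i : I) (w : NegAlg K A) :
    vermaHom K hA i w 2 0 = 0 ∧ vermaHom K hA i w 2 1 = 0 ∧ vermaHom K hA i w 2 2 = w := by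
  refine mem_of_stable
    { carrier := {w | vermaHom K hA i w 2 0 = 0 ∧ vermaHom K hA i w 2 1 = 0 ∧
        vermaHom K hA i w 2 2 = w}
      add_mem' := ?_, zero_mem' := ?_, smul_mem' := ?_ } ?_ ?_ w
  · rintro a b ⟨h0, h1, h2⟩ ⟨h0', h1', h2'⟩
    simp [h0, h1, h2, h0', h1', h2']
  · simp
  · rintro t a ⟨h0, h1, h2⟩
    simp [h0, h1, h2]
  · simp
  · rintro j a ⟨h0, h1, h2⟩
    have hg : vermaHom K hA i (gen K A j) = vermaMatrix K A i j := lift_gen _ _ _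
    simp [hg, vermaMatrix, Matrix.mul_apply, Fin.sum_univ_three, h0, h1, h2]

/-- The operator `h i` on the Verma module of highest weight `c`. -/
def opH (i : I) : Module.End K (NegAlg K A) where
  -- Row `1` of the matrix applied to the column `(0, c i, 1)`; `opE` uses row `0` with the same
  -- column.
  toFun w := c i • vermaHom K hA i w 1 1 + vermaHom K hA i w 1 2
  map_add' v w := by simp only [map_add, Matrix.add_apply, smul_add]; abel
  map_smul' t w := by simp [smul_comm t]

/-- The operator `e i` on the Verma module of highest weight `c`. -/
def opE (i : I) : Module.End K (NegAlg K A) where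
  toFun w := c i • vermaHom K hA i w 0 1 + vermaHom K hA i w 0 2
  map_add' v w := by simp only [map_add, Matrix.add_apply, smul_add]; abel
  map_smul' t w := by simp [smul_comm t]

@[simp] theorem opH_one (i : I) : opH hA c i 1 = c i • 1 := by
  simp [opH]

@[simp] theorem opE_one (i : I) : opE hA c i 1 = 0 := by
  simp [opE]

theorem opH_gen_mul (i j : I) (w : NegAlg K A) :
    opH hA c i (gen K A j * w) =
      gen K A j * opH hA c i w - algebraMap ℝ K (A i j) • (gen K A j * w) := by
  have hg : vermaHom K hA i (gen K A j) = vermaMatrix K A i j := lift_gen _ _ _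
  obtain ⟨h0, h1, h2⟩ := vermaHom_two_two hA i w
  simp [opH, hg, vermaMatrix, Matrix.mul_apply, Fin.sum_univ_three, h1, h2, mul_add, -algebraMap_smul]
  abel

open Classical in
theorem opE_gen_mul (i j : I) (w : NegAlg K A) :
    opE hA c i (gen K A j * w) = gen K A j * opE hA c i w + if i = j then opH hA c i w else 0 := by
  have hg : vermaHom K hA i (gen K A j) = vermaMatrix K A i j := lift_gen _ _ _
  obtain ⟨h0, h1, h2⟩ := vermaHom_two_two hA i w
  split_ifs with hij
  · subst hij
    simp [opE, opH, hg, vermaMatrix, Matrix.mul_apply, Fin.sum_univ_three, mul_add]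
    abel
  · simp [opE, hg, vermaMatrix, Matrix.mul_apply, Fin.sum_univ_three, hij, mul_add]

theorem lie_opH_opF (i j : I) :
    ⁅opH hA c i, opF K A j⁆ = -(algebraMap ℝ K (A i j) • opF K A j) := by
  ext w
  simp [Ring.lie_def, opH_gen_mul]

open Classical in
theorem lie_opE_opF (i j : I) :
    ⁅opE hA c i, opF K A j⁆ = if i = j then opH hA c i else 0 := by
  ext w
  split_ifs with hij
  · subst hij; simp [Ring.lie_def, opE_gen_mul]
  · simp [Ring.lie_def, opE_gen_mul, hij]

/-- This and the next two relations need no formula on general vectors: by `eq_zero_of_lie_opF` it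
suffices to evaluate at `1` and to commute with each `opF`. The Jacobi identity reduces the latter
to relations already known. -/
theorem lie_opH_opH (i j : I) : ⁅opH hA c i, opH hA c j⁆ = 0 := by
  refine eq_zero_of_lie_opF _ ?_ fun k => ?_
  · simp [Ring.lie_def, smul_smul, mul_comm]
  · rw [lie_lie, lie_opH_opF, lie_opH_opF]
    simp only [lie_neg, lie_smul_end, lie_opH_opF, smul_neg, smul_smul]
    rw [mul_comm, sub_self]

theorem lie_opH_opE (i j : I) :
    ⁅opH hA c i, opE hA c j⁆ = algebraMap ℝ K (A i j) • opE hA c j := by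
  rw [← sub_eq_zero]
  refine eq_zero_of_lie_opF _ ?_ fun k => ?_
  · simp [Ring.lie_def]
  · rw [sub_lie, smul_lie, lie_lie, lie_opE_opF, lie_opH_opF]
    split_ifs with hjk
    · simp only [lie_opH_opH, lie_neg, lie_smul_end, lie_opE_opF, hjk]
      simp
    · simp only [lie_neg, lie_smul_end, lie_opE_opF, if_neg hjk]
      simp

theorem lie_opE_opE (i j : I) (hij : A i j = 0) : ⁅opE hA c i, opE hA c j⁆ = 0 := by
  have hji : A j i = 0 := by rw [hA, hij]
  refine eq_zero_of_lie_opF _ ?_ fun k => ?_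
  · simp [Ring.lie_def]
  · have h1 : ⁅opE hA c i, opH hA c j⁆ = 0 := by rw [← lie_skew, lie_opH_opE, hji]; simp
    have h2 : ⁅opE hA c j, opH hA c i⁆ = 0 := by rw [← lie_skew, lie_opH_opE, hij]; simp
    rw [lie_lie, lie_opE_opF, lie_opE_opF]
    split_ifs <;> simp [h1, h2]

theorem isChevalley_verma : IsChevalley K A (opE hA c) (opF K A) (opH hA c) where
  hh := lie_opH_opH hA c
  he := lie_opH_opE hA c
  hf := lie_opH_opF hA c
  ef_same i := by simp [lie_opE_opF]
  ef_ne i j hij := by simp [lie_opE_opF, hij]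
  ee := lie_opE_opE hA c
  ff i j hij := by
    rw [opF, opF, Ring.lie_def, ← map_mul, ← map_mul, gen_comm hij, sub_self]

end NegAlg

variable [Algebra ℝ K]

/-- The Verma module of highest weight `c`. -/
def verma (hdiag : ∀ i, A i i ≤ 0) (hA : ∀ i j, A i j = A j i) (c : I → K) :
    BorcherdsAlgebra K A →ₗ⁅K⁆ Module.End K (NegAlg K A) :=
  lift hdiag (NegAlg.isChevalley_verma hA c)

end

end BorcherdsAlg

/-! ### The action of `NegAlg` on the free Lie algebra extended by the Euler derivation -/

namespace BorcherdsAlg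

noncomputable section

section AdMulti

variable {K : Type*} [Field K] {J L M : Type*} [LieRing L] [LieAlgebra K L] [LieRing M]
  [LieAlgebra K M]

/-- The iterated bracket of `v` with the `x j`, for `j` in a multiset. -/
def adMulti (x : J → L) (s : Multiset J) (v : L) : L :=
  s.toList.foldr (fun j w => ⁅x j, w⁆) v

@[simp] theorem adMulti_zero (x : J → L) (v : L) : adMulti x 0 v = v := by
  simp [adMulti]

/-- By the Jacobi identity the operators `ad (x j)` commute when the `x j` do, so the arbitrary
order chosen by `Multiset.toList` is immaterial. -/
theorem adMulti_coe {x : J → L} (hx : ∀ j k, ⁅x j, x k⁆ = 0) (l : List J) (v : L) :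
    adMulti x (l : Multiset J) v = l.foldr (fun j w => ⁅x j, w⁆) v := by
  have : LeftCommutative fun (j : J) (w : L) => ⁅x j, w⁆ :=
    ⟨fun j k w => by rw [leibniz_lie, hx, zero_lie, zero_add]⟩
  exact (Multiset.coe_eq_coe.1 (Multiset.coe_toList (l : Multiset J))).foldr_eq v

theorem adMulti_cons {x : J → L} (hx : ∀ j k, ⁅x j, x k⁆ = 0) (j : J) (s : Multiset J) (v : L) :
    adMulti x (j ::ₘ s) v = ⁅x j, adMulti x s v⁆ := by
  induction s using Quotient.inductionOn with
  | h l =>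
    change adMulti x ((j :: l : List J) : Multiset J) v = ⁅x j, adMulti x (l : Multiset J) v⁆
    rw [adMulti_coe hx, adMulti_coe hx, List.foldr_cons]

theorem map_adMulti (φ : L →ₗ⁅K⁆ M) (x : J → L) (s : Multiset J) (v : L) :
    φ (adMulti x s v) = adMulti (fun j => φ (x j)) s (φ v) := by
  unfold adMulti
  induction s.toList with
  | nil => rfl
  | cons j l ih => simp [ih]

end AdMulti

variable {K : Type*} [Field K] {I : Type*} {A : Matrix I I ℝ}

/-- The index set of the free generators: an unordered form of `UIndex`. -/
abbrev WIndex {I : Type*} (A : Matrix I I ℝ) : Type _ :=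
  Multiset (zeroSet A) × {i : I // i ∉ zeroSet A}

/-- The element of index `t`, for a family `x` of elements of a Lie algebra. -/
def mono {L : Type*} [LieRing L] (x : I → L) (t : WIndex A) : L :=
  adMulti (fun j : zeroSet A => x j) t.1 (x t.2)

theorem map_mono {L M : Type*} [LieRing L] [LieAlgebra K L] [LieRing M] [LieAlgebra K M]
    (φ : L →ₗ⁅K⁆ M) (x : I → L) (t : WIndex A) : φ (mono x t) = mono (fun i => φ (x i)) t :=
  map_adMulti φ _ _ _

theorem mono_cons {L : Type*} [LieRing L] {x : I → L}
    (hx : ∀ j k : zeroSet A, ⁅x j, x k⁆ = 0) (j : zeroSet A) (s : Multiset (zeroSet A))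
    (i : {i : I // i ∉ zeroSet A}) : mono x (j ::ₘ s, i) = ⁅x j, mono x (s, i)⁆ :=
  adMulti_cons hx j s _

theorem mono_zero {L : Type*} [LieRing L] (x : I → L) (i : {i : I // i ∉ zeroSet A}) :
    mono x (0, i) = x i :=
  adMulti_zero _ _

section Euler

variable (K A) in
/-- The derivation of the free Lie algebra that corresponds to the bracket with the generator
`j`. -/
def insertion (j : zeroSet A) :
    FreeLieAlgebra K (WIndex A) →ₗ[K] FreeLieAlgebra K (WIndex A) :=
  FreeLieAlgebra.derivation fun t => FreeLieAlgebra.of K (j ::ₘ t.1, t.2)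

theorem insertion_of (j : zeroSet A) (t : WIndex A) :
    insertion K A j (FreeLieAlgebra.of K t) = FreeLieAlgebra.of K (j ::ₘ t.1, t.2) := by
  simp [insertion]

theorem insertion_comm (j k : zeroSet A) (y : FreeLieAlgebra K (WIndex A)) :
    insertion K A j (insertion K A k y) = insertion K A k (insertion K A j y) :=
  FreeLieAlgebra.derivation_comm _ _ (fun t => by simp [Multiset.cons_swap]) y

theorem insertion_euler (j : zeroSet A) (y : FreeLieAlgebra K (WIndex A)) :
    insertion K A j (FreeLieAlgebra.euler K _ y) = FreeLieAlgebra.euler K _ (insertion K A j y) :=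
  FreeLieAlgebra.derivation_comm _ _ (fun t => by simp) y

variable (K) in
/-- The adjoint action of a free Lie algebra on its extension by the Euler derivation. -/
def eulerAd (X : Type*) :
    FreeLieAlgebra K X →ₗ⁅K⁆ Module.End K (FreeLieAlgebra K X × K) where
  toFun x :=
    -- The second coordinate is the coefficient of an added element `D` with `⁅x, D⁆ = euler x`. The
    -- bare adjoint action would not do: it vanishes on the free Lie algebra on one generator.
    { toFun := fun v => (⁅x, v.1⁆ + v.2 • FreeLieAlgebra.euler K X x, 0)
      map_add' := fun v w => by
        ext
        · simp only [Prod.fst_add, Prod.snd_add, lie_add, add_smul]; abel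
        · simp
      map_smul' := fun t v => by
        ext
        · simp [smul_smul]
        · simp }
  map_add' x y := by
    ext v <;> simp
  map_smul' t x := by
    ext v <;> simp
  map_lie' := by
    intro x y
    refine LinearMap.ext fun v => Prod.ext ?_ ?_
    · change ⁅⁅x, y⁆, v.1⁆ + v.2 • FreeLieAlgebra.euler K X ⁅x, y⁆ =
        (⁅x, ⁅y, v.1⁆ + v.2 • FreeLieAlgebra.euler K X y⁆ + (0 : K) • FreeLieAlgebra.euler K X x) -
        (⁅y, ⁅x, v.1⁆ + v.2 • FreeLieAlgebra.euler K X x⁆ + (0 : K) • FreeLieAlgebra.euler K X y)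
      simp only [FreeLieAlgebra.euler, FreeLieAlgebra.derivation_lie]
      rw [← lie_skew (FreeLieAlgebra.derivation _ x) y]
      simp only [lie_lie, lie_add, lie_smul, smul_add, smul_neg, zero_smul]
      abel
    · exact (sub_zero (0 : K)).symm

theorem eulerAd_apply (X : Type*) (x : FreeLieAlgebra K X) (v : FreeLieAlgebra K X × K) :
    eulerAd K X x v = (⁅x, v.1⁆ + v.2 • FreeLieAlgebra.euler K X x, 0) := rfl

open Classical in
variable (K A) in
/-- The action of the generators of `NegAlg` on the free Lie algebra, extended by the Euler
derivation. -/
def negOp (i : I) : Module.End K (FreeLieAlgebra K (WIndex A) × K) :=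
  -- Insertions commute with the Euler derivation, so they extend by zero to the added coordinate.
  if hi : i ∈ zeroSet A then
    LinearMap.inl K _ _ ∘ₗ insertion K A ⟨i, hi⟩ ∘ₗ LinearMap.fst K _ _
  else eulerAd K _ (FreeLieAlgebra.of K (0, ⟨i, hi⟩))

theorem negOp_mem (j : zeroSet A) (v : FreeLieAlgebra K (WIndex A) × K) :
    negOp K A j v = (insertion K A j v.1, 0) := by
  rw [negOp, dif_pos j.2]
  rfl

theorem negOp_notMem (i : {i : I // i ∉ zeroSet A}) :
    negOp K A i = eulerAd K _ (FreeLieAlgebra.of K (0, i)) := by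
  rw [negOp, dif_neg i.2]

theorem negOp_comm (j k : zeroSet A) :
    negOp K A j * negOp K A k = negOp K A k * negOp K A j := by
  refine LinearMap.ext fun v => ?_
  rw [Module.End.mul_apply, Module.End.mul_apply, negOp_mem, negOp_mem, negOp_mem, negOp_mem,
    insertion_comm]

/-- The commutator of a derivation `δ` with `ad x` is `ad (δ x)`. This survives the extension
because insertion preserves the number of generators in a bracket (`insertion_euler`). -/
theorem lie_negOp_eulerAd (j : zeroSet A) (x : FreeLieAlgebra K (WIndex A)) :
    ⁅negOp K A j, eulerAd K _ x⁆ = eulerAd K _ (insertion K A j x) := by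
  refine LinearMap.ext fun v => ?_
  rw [Ring.lie_def, LinearMap.sub_apply, Module.End.mul_apply, Module.End.mul_apply, negOp_mem,
    negOp_mem, eulerAd_apply, eulerAd_apply, eulerAd_apply, ← insertion_euler]
  ext
  · simp only [Prod.fst_sub, map_add, map_smul, zero_smul, add_zero]
    have : insertion K A j ⁅x, v.1⁆ = ⁅x, insertion K A j v.1⁆ + ⁅insertion K A j x, v.1⁆ :=
      FreeLieAlgebra.derivation_lie _ _ _
    rw [this]
    abel
  · simp

theorem mono_negOp (t : WIndex A) : mono (negOp K A) t = eulerAd K _ (FreeLieAlgebra.of K t) := by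
  obtain ⟨s, i⟩ := t
  induction s using Multiset.induction with
  | empty => rw [mono_zero, negOp_notMem]
  | cons j s ih =>
    rw [mono_cons, ih, lie_negOp_eulerAd, insertion_of]
    intro j k
    rw [Ring.lie_def, negOp_comm, sub_self]

/-- The action of `NegAlg` on the free Lie algebra, extended by the Euler derivation. -/
def negRep (hz : ∀ i j, A i j = 0 → i ∈ zeroSet A ∧ j ∈ zeroSet A) :
    NegAlg K A →ₐ[K] Module.End K (FreeLieAlgebra K (WIndex A) × K) :=
  -- All defining relations of `NegAlg` have both indices in `J`, because zeros of `A` occur only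
  -- there; insertions commute, while nothing is asked of the other operators.
  NegAlg.lift (negOp K A) fun i j hij => negOp_comm ⟨i, (hz i j hij).1⟩ ⟨j, (hz i j hij).2⟩

theorem negRep_mono (hz : ∀ i j, A i j = 0 → i ∈ zeroSet A ∧ j ∈ zeroSet A) (t : WIndex A) :
    negRep hz (mono (NegAlg.gen K A) t) = eulerAd K _ (FreeLieAlgebra.of K t) := by
  have := map_mono (negRep (K := K) hz).toLieHom (NegAlg.gen K A) t
  rw [← mono_negOp]
  refine this.trans ?_
  congr 1
  ext1 i
  exact NegAlg.lift_gen _ _ i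

/-- Applied to `(0, 1)`, the right side is `(euler x, 0)`, so no nonzero `x` can die in `NegAlg`. -/
theorem negRep_lift_mono (hz : ∀ i j, A i j = 0 → i ∈ zeroSet A ∧ j ∈ zeroSet A)
    (x : FreeLieAlgebra K (WIndex A)) :
    negRep hz (FreeLieAlgebra.lift K (mono (NegAlg.gen K A)) x) = eulerAd K _ x := by
  have : (negRep (K := K) hz).toLieHom.comp (FreeLieAlgebra.lift K (mono (NegAlg.gen K A))) =
      eulerAd K _ := by
    ext1 t
    simpa using negRep_mono hz t
  exact LieHom.congr_fun this x

end Euler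

end

end BorcherdsAlg

/-! ### Linear independence of the three parts -/

namespace BorcherdsAlg

noncomputable section

theorem map_linearCombination {R J L M : Type*} [CommRing R] [LieRing L] [LieAlgebra R L]
    [LieRing M] [LieAlgebra R M] (φ : L →ₗ⁅R⁆ M) (v : J → L) (l : J →₀ R) :
    φ (Finsupp.linearCombination R v l) = Finsupp.linearCombination R (fun j => φ (v j)) l :=
  Finsupp.apply_linearCombination R φ.toLinearMap v l

section Independence

variable {K : Type*} [Field K] {I : Type*} {A : Matrix I I ℝ}

theorem mono_mem {L : Type*} [LieRing L] [LieAlgebra K L] (S : LieSubalgebra K L) (x : I → L)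
    (hx : ∀ i, x i ∈ S) (t : WIndex A) : mono x t ∈ S := by
  have := map_mono S.incl (fun i => (⟨x i, hx i⟩ : S)) t
  have h2 : mono x t = S.incl (mono (fun i => (⟨x i, hx i⟩ : S)) t) := this.symm
  rw [h2]
  exact Subtype.property _

variable [Algebra ℝ K]

variable (K A) in
/-- The homomorphism from the free Lie algebra to the positive part. -/
def posHom : FreeLieAlgebra K (WIndex A) →ₗ⁅K⁆ BorcherdsAlgebra K A :=
  FreeLieAlgebra.lift K (mono (e K A))

variable (K A) in
/-- The homomorphism from the free Lie algebra to the negative part. -/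
def negHom : FreeLieAlgebra K (WIndex A) →ₗ⁅K⁆ BorcherdsAlgebra K A :=
  FreeLieAlgebra.lift K (mono (f K A))

variable (hdiag : ∀ i, A i i ≤ 0) (hA : ∀ i j, A i j = A j i)
  (hz : ∀ i j, A i j = 0 → i ∈ zeroSet A ∧ j ∈ zeroSet A)

/-- The operators that kill the highest weight vector `1` form a Lie subalgebra, and it contains
every `opE`. -/
theorem verma_posHom (c : I → K) (x : FreeLieAlgebra K (WIndex A)) :
    verma hdiag hA c (posHom K A x) 1 = 0 := by
  let S : LieSubalgebra K (Module.End K (NegAlg K A)) :=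
    { carrier := {X | X 1 = 0}
      add_mem' := fun {X Y} hX hY => by
        change (X + Y) 1 = 0
        rw [LinearMap.add_apply, show X 1 = 0 from hX, show Y 1 = 0 from hY, add_zero]
      zero_mem' := rfl
      smul_mem' := fun t X hX => by
        change (t • X) 1 = 0
        rw [LinearMap.smul_apply, show X 1 = 0 from hX, smul_zero]
      lie_mem' := fun {X Y} hX hY => by
        change ⁅X, Y⁆ 1 = 0
        rw [Ring.lie_def, LinearMap.sub_apply, Module.End.mul_apply, Module.End.mul_apply,
          show X 1 = 0 from hX, show Y 1 = 0 from hY, map_zero, map_zero, sub_zero] }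
  refine FreeLieAlgebra.mem_of_of_mem (S.comap ((verma hdiag hA c).comp (posHom K A)))
    (fun t => ?_) x
  change verma hdiag hA c (posHom K A (FreeLieAlgebra.of K t)) ∈ S
  rw [posHom, FreeLieAlgebra.lift_of_apply, map_mono]
  refine mono_mem S _ (fun i => ?_) t
  change verma hdiag hA c (e K A i) 1 = 0
  rw [verma, lift_e, NegAlg.opE_one]

theorem verma_negHom (c : I → K) (x : FreeLieAlgebra K (WIndex A)) :
    verma hdiag hA c (negHom K A x) =
      Algebra.lmul K (NegAlg K A) (FreeLieAlgebra.lift K (mono (NegAlg.gen K A)) x) := by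
  have : (verma hdiag hA c).comp (negHom K A) = (Algebra.lmul K (NegAlg K A)).toLieHom.comp
      (FreeLieAlgebra.lift K (mono (NegAlg.gen K A))) := by
    ext1 t
    rw [LieHom.comp_apply, LieHom.comp_apply, negHom, FreeLieAlgebra.lift_of_apply,
      FreeLieAlgebra.lift_of_apply, map_mono, map_mono]
    congr 1
    ext1 i
    exact lift_f _ _ i
  exact LieHom.congr_fun this x

/-- The linear map that detects the negative part and the Cartan part. -/
def detect (c : I → K) : BorcherdsAlgebra K A →ₗ[K] FreeLieAlgebra K (WIndex A) × K :=
  LinearMap.applyₗ ((0, 1) : FreeLieAlgebra K (WIndex A) × K) ∘ₗ (negRep hz).toLinearMap ∘ₗ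
    LinearMap.applyₗ (1 : NegAlg K A) ∘ₗ (verma hdiag hA c).toLinearMap

theorem detect_apply (c : I → K) (x : BorcherdsAlgebra K A) :
    detect hdiag hA hz c x = negRep hz (verma hdiag hA c x 1) (0, 1) := rfl

theorem detect_posHom (c : I → K) (x : FreeLieAlgebra K (WIndex A)) :
    detect hdiag hA hz c (posHom K A x) = 0 := by
  rw [detect_apply, verma_posHom, map_zero, LinearMap.zero_apply]

theorem detect_negHom (c : I → K) (x : FreeLieAlgebra K (WIndex A)) :
    detect hdiag hA hz c (negHom K A x) = (FreeLieAlgebra.euler K _ x, 0) := by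
  rw [detect_apply, verma_negHom,
    show ∀ w : NegAlg K A, Algebra.lmul K (NegAlg K A) w 1 = w from mul_one,
    negRep_lift_mono, eulerAd_apply]
  simp

theorem detect_e (c : I → K) (i : I) : detect hdiag hA hz c (e K A i) = 0 := by
  rw [detect_apply, verma, lift_e, NegAlg.opE_one, map_zero, LinearMap.zero_apply]

/-- An insertion sees only the first coordinate of `(0, 1)`, which is zero. The coefficients of
these `f j` must therefore be found by other means, in `combination_eq_zero`. -/
theorem detect_f (c : I → K) (j : zeroSet A) : detect hdiag hA hz c (f K A j) = 0 := by
  rw [detect_apply, verma, lift_f, NegAlg.opF_apply, mul_one, negRep, NegAlg.lift_gen, negOp_mem,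
    map_zero]
  rfl

theorem detect_h (c : I → K) (i : I) : detect hdiag hA hz c (h K A i) = (0, c i) := by
  rw [detect_apply, verma, lift_h, NegAlg.opH_one, map_smul, map_one]
  simp

/-- A general element of the sum of the three parts. -/
def combination (x : FreeLieAlgebra K (WIndex A)) (a : zeroSet A →₀ K) (c : I →₀ K)
    (b : zeroSet A →₀ K) (y : FreeLieAlgebra K (WIndex A)) : BorcherdsAlgebra K A :=
  negHom K A x + (Finsupp.linearCombination K (fun j : zeroSet A => f K A j) a +
    Finsupp.linearCombination K (h K A) c +
    Finsupp.linearCombination K (fun j : zeroSet A => e K A j) b) + posHom K A y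

include hA hz hdiag in
-- The first coordinate of `detect` is `euler x`, and `euler` is injective. The second is a linear
-- form in the coefficients of the `h i`, with the highest weight as free parameter; the weight
-- `Pi.single i 1` isolates the coefficient of `h i`.
theorem neg_cartan_eq_zero {x y : FreeLieAlgebra K (WIndex A)} {a b : zeroSet A →₀ K}
    {c : I →₀ K} (hs : combination x a c b y = 0) : x = 0 ∧ c = 0 := by
  classical
  have : CharZero K := charZero_of_injective_algebraMap (algebraMap ℝ K).injective
  have key : ∀ d : I → K, (FreeLieAlgebra.euler K _ x, Finsupp.linearCombination K d c) = 0 := by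
    intro d
    have := congrArg (detect hdiag hA hz d) hs
    rw [combination, map_zero] at this
    simp only [map_add, detect_negHom, detect_posHom, Finsupp.apply_linearCombination,
      Function.comp_def] at this
    simp only [detect_e, detect_f, detect_h] at this
    simp only [Finsupp.linearCombination_apply, Finsupp.sum, smul_zero, Finset.sum_const_zero,
      add_zero, zero_add] at this ⊢
    rw [← this]
    simp [Prod.ext_iff, Prod.fst_sum, Prod.snd_sum]
  constructor
  · apply FreeLieAlgebra.euler_injective K
    rw [map_zero]
    exact congrArg Prod.fst (key 0)
  · ext i
    have := congrArg Prod.snd (key (Pi.single i 1))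
    simpa [Finsupp.linearCombination_apply, Finsupp.sum, Pi.single_apply] using this

theorem chevalleyInvolution_combination (x y : FreeLieAlgebra K (WIndex A))
    (a b : zeroSet A →₀ K) (c : I →₀ K) :
    chevalleyInvolution K hdiag (combination x a c b y) = combination y b (-c) a x := by
  have hp : ∀ x, chevalleyInvolution K hdiag (posHom K A x) = negHom K A x := by
    intro x
    refine LieHom.congr_fun (f := (chevalleyInvolution K hdiag).comp (posHom K A)) ?_ x
    ext1 t
    rw [LieHom.comp_apply, posHom, negHom, FreeLieAlgebra.lift_of_apply,
      FreeLieAlgebra.lift_of_apply, map_mono]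
    congr 1
    ext1 i
    exact lift_e _ _ i
  have hn : ∀ x, chevalleyInvolution K hdiag (negHom K A x) = posHom K A x := by
    intro x
    rw [← hp, chevalleyInvolution_involutive]
  have hh : Finsupp.linearCombination K (fun i => -h K A i) c =
      Finsupp.linearCombination K (h K A) (-c) := by
    simp [Finsupp.linearCombination_apply, Finsupp.sum]
  unfold combination
  simp only [map_add, hp, hn, map_linearCombination]
  simp only [chevalleyInvolution, lift_e, lift_f, lift_h, hh]
  abel

include hA hz hdiag in
/-- The sum of the negative part, the Levi part and the positive part is direct, and the generators
of the Levi part are linearly independent. -/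
theorem combination_eq_zero (hJ : ∀ j k : zeroSet A, A j k = 0)
    {x y : FreeLieAlgebra K (WIndex A)} {a b : zeroSet A →₀ K} {c : I →₀ K}
    (hs : combination x a c b y = 0) : x = 0 ∧ a = 0 ∧ c = 0 ∧ b = 0 ∧ y = 0 := by
  classical
  have hs' : combination y b (-c) a x = 0 := by
    rw [← chevalleyInvolution_combination hdiag, hs, map_zero]
  obtain ⟨rfl, rfl⟩ := neg_cartan_eq_zero hdiag hA hz hs
  obtain ⟨rfl, -⟩ := neg_cartan_eq_zero hdiag hA hz hs'
  -- Bracketing with `e k` kills every `e j` and every `f j` with `j ≠ k`, which leaves `a k • h k =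
  -- 0`; the `h i` are already known to be independent. The claim for `b` is the same statement
  -- after the Chevalley involution.
  have hlin : ∀ {a b : zeroSet A →₀ K}, combination 0 a 0 b 0 = 0 → a = 0 := by
    intro a b hab
    ext k
    have h1 := congrArg (LieAlgebra.ad K _ (e K A k)) hab
    rw [combination] at h1
    simp only [map_zero, map_add, Finsupp.apply_linearCombination, Function.comp_def,
      LieAlgebra.ad_apply, add_zero, zero_add, (isChevalley K A).ee _ _ (hJ k _)] at h1
    have h2 : ∀ j : zeroSet A, ⁅e K A k, f K A j⁆ = (Pi.single k (h K A k) : zeroSet A → _) j := by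
      intro j
      by_cases hjk : j = k
      · subst hjk; simp [(isChevalley K A).ef_same]
      · rw [(isChevalley K A).ef_ne _ _ fun hk => hjk (Subtype.ext hk.symm),
          Pi.single_eq_of_ne hjk]
    simp only [h2] at h1
    have h3 : a k • h K A k = 0 := by
      rw [← h1]
      simp [Finsupp.linearCombination_apply, Finsupp.sum, Pi.single_apply]
      intro h0
      simp [h0]
    have h4 : combination 0 0 (Finsupp.single (k : I) (a k)) 0 (0 : FreeLieAlgebra K (WIndex A)) =
        0 := by
      simp [combination, h3]
    simpa using (neg_cartan_eq_zero hdiag hA hz h4).2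
  refine ⟨rfl, hlin hs, rfl, hlin (by simpa using hs'), rfl⟩

end Independence

end

end BorcherdsAlg

/-! ### The three parts span -/

namespace BorcherdsAlg

noncomputable section

section Spanning

variable {K : Type*} [Field K] {I : Type*} {A : Matrix I I ℝ}
variable {L : Type*} [LieRing L] [LieAlgebra K L] {x y z : I → L}

variable (K A) in
/-- The image of the free Lie algebra under the homomorphism given by the family `x`. -/
def freePart (x : I → L) : Submodule K L :=
  (FreeLieAlgebra.lift K (mono (A := A) x)).range.toSubmodule

variable (K A) in
/-- The span of the `x j` and `y j` for `j` in `J` and of all `z i`. -/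
def levi (x y z : I → L) : Submodule K L :=
  Submodule.span K (Set.range fun j : zeroSet A => y j) ⊔ Submodule.span K (Set.range z) ⊔
    Submodule.span K (Set.range fun j : zeroSet A => x j)

variable (K A) in
/-- The sum of the three parts. -/
def total (x y z : I → L) : Submodule K L :=
  freePart K A y ⊔ levi K A x y z ⊔ freePart K A x

theorem mono_mem_freePart (x : I → L) (t : WIndex A) : mono x t ∈ freePart K A x :=
  ⟨FreeLieAlgebra.of K t, FreeLieAlgebra.lift_of_apply _ _⟩

theorem mem_freePart (x : I → L) (i : I) (hi : i ∉ zeroSet A) : x i ∈ freePart K A x := by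
  have := mono_mem_freePart (K := K) x (0, (⟨i, hi⟩ : {i : I // i ∉ zeroSet A}))
  rwa [mono_zero] at this

theorem lie_mem_freePart (x : I → L) {v w : L} (hv : v ∈ freePart K A x)
    (hw : w ∈ freePart K A x) : ⁅v, w⁆ ∈ freePart K A x :=
  (FreeLieAlgebra.lift K (mono (A := A) x)).range.lie_mem hv hw

/-- In `⁅d, ⁅a, b⁆⁆ = ⁅⁅d, a⁆, b⁆ + ⁅a, ⁅d, b⁆⁆` the inner brackets lie in `S ⊔ freePart`, which
maps `freePart` to itself. So the elements that `d` sends into the sum form a subalgebra, and the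
generators suffice. -/
theorem lie_mem_sup (x : I → L) (d : L) (S : Submodule K L)
    (hS : ∀ s ∈ S, ∀ w ∈ freePart K A x, ⁅s, w⁆ ∈ freePart K A x)
    (hd : ∀ t : WIndex A, ⁅d, mono x t⁆ ∈ S ⊔ freePart K A x) {w : L}
    (hw : w ∈ freePart K A x) : ⁅d, w⁆ ∈ S ⊔ freePart K A x := by
  have hS' : ∀ s ∈ S ⊔ freePart K A x, ∀ w ∈ freePart K A x, ⁅s, w⁆ ∈ freePart K A x := by
    intro s hs w hw
    obtain ⟨a, ha, p, hp, rfl⟩ := Submodule.mem_sup.1 hs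
    rw [add_lie]
    exact add_mem (hS a ha w hw) (lie_mem_freePart x hp hw)
  let φ := FreeLieAlgebra.lift K (mono (A := A) x)
  obtain ⟨v, rfl⟩ := hw
  refine FreeLieAlgebra.mem_of_of_mem (K := K) (X := WIndex A)
    { (S ⊔ freePart K A x).comap ((LieAlgebra.ad K L d) ∘ₗ φ.toLinearMap) with
      lie_mem' := ?_ } (fun t => ?_) v
  · intro a b ha hb
    change ⁅d, φ a⁆ ∈ S ⊔ freePart K A x at ha
    change ⁅d, φ b⁆ ∈ S ⊔ freePart K A x at hb
    change ⁅d, φ ⁅a, b⁆⁆ ∈ S ⊔ freePart K A x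
    rw [LieHom.map_lie, leibniz_lie]
    refine Submodule.mem_sup_right (add_mem (hS' _ ha _ ⟨b, rfl⟩) ?_)
    rw [← lie_skew]
    exact neg_mem (hS' _ hb _ ⟨a, rfl⟩)
  · change ⁅d, φ (FreeLieAlgebra.of K t)⁆ ∈ S ⊔ freePart K A x
    simpa [φ] using hd t

theorem lie_mem_freePart_of_mono (x : I → L) (d : L)
    (hd : ∀ t : WIndex A, ⁅d, mono x t⁆ ∈ freePart K A x) {w : L}
    (hw : w ∈ freePart K A x) : ⁅d, w⁆ ∈ freePart K A x := by
  have := lie_mem_sup (K := K) (A := A) x d ⊥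
    (fun s hs w _ => by rw [(Submodule.mem_bot K).1 hs, zero_lie]; exact zero_mem _)
    (by simpa using hd) hw
  simpa using this

variable [Algebra ℝ K] (H : IsChevalley K A x y z) (hJ : ∀ j k : zeroSet A, A j k = 0)

include H hJ

theorem x_lie_mono (j : zeroSet A) (t : WIndex A) : ⁅x j, mono x t⁆ ∈ freePart K A x := by
  rw [← mono_cons (fun j k => H.ee _ _ (hJ j k))]
  exact mono_mem_freePart _ _

theorem x_lie_freePart (i : I) {w : L} (hw : w ∈ freePart K A x) :
    ⁅x i, w⁆ ∈ freePart K A x := by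
  by_cases hi : i ∈ zeroSet A
  · exact lie_mem_freePart_of_mono x _ (x_lie_mono H hJ ⟨i, hi⟩) hw
  · exact lie_mem_freePart x (mem_freePart x i hi) hw

theorem z_lie_freePart (i : I) {w : L} (hw : w ∈ freePart K A x) :
    ⁅z i, w⁆ ∈ freePart K A x := by
  refine lie_mem_freePart_of_mono x _ ?_ hw
  rintro ⟨s, k⟩
  induction s using Multiset.induction with
  | empty =>
    rw [mono_zero, H.he]
    exact Submodule.smul_mem _ _ (mem_freePart x k k.2)
  | cons j s ih =>
    rw [mono_cons (fun j k => H.ee _ _ (hJ j k)), leibniz_lie, H.he, smul_lie]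
    exact add_mem (Submodule.smul_mem _ _ (x_lie_freePart H hJ _ (mono_mem_freePart _ _)))
      (x_lie_freePart H hJ _ ih)

/-- Moving `y i` past an `x j` costs at most a `z i`, which preserves `freePart`. At the innermost
`x k` it vanishes, since `k ∉ J` differs from `i ∈ J`. -/
theorem y_lie_freePart (i : zeroSet A) {w : L} (hw : w ∈ freePart K A x) :
    ⁅y i, w⁆ ∈ freePart K A x := by
  refine lie_mem_freePart_of_mono x _ ?_ hw
  rintro ⟨s, k⟩
  induction s using Multiset.induction with
  | empty =>
    rw [mono_zero, ← lie_skew, H.ef_ne k i fun h => k.2 (h ▸ i.2), neg_zero]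
    exact zero_mem _
  | cons j s ih =>
    rw [mono_cons (fun j k => H.ee _ _ (hJ j k)), leibniz_lie, ← lie_skew (y i) (x j), neg_lie]
    refine add_mem (neg_mem ?_) (x_lie_freePart H hJ _ ih)
    by_cases hij : (j : I) = i
    · rw [hij, H.ef_same]
      exact z_lie_freePart H hJ _ (mono_mem_freePart _ _)
    · rw [H.ef_ne _ _ hij, zero_lie]
      exact zero_mem _

theorem levi_lie_freePart {d w : L} (hd : d ∈ levi K A x y z) (hw : w ∈ freePart K A x) :
    ⁅d, w⁆ ∈ freePart K A x := by
  have : levi K A x y z ≤ (freePart K A x).comap ((LieAlgebra.ad K L).toLinearMap.flip w) := by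
    refine sup_le (sup_le ?_ ?_) ?_ <;> rw [Submodule.span_le] <;> rintro _ ⟨j, rfl⟩
    · exact y_lie_freePart H hJ j hw
    · exact z_lie_freePart H hJ j hw
    · exact x_lie_freePart H hJ j hw
  exact this hd

omit H hJ [Algebra ℝ K] in
theorem x_mem_levi (j : zeroSet A) : x j ∈ levi K A x y z :=
  Submodule.mem_sup_right (Submodule.subset_span ⟨j, rfl⟩)

omit H hJ [Algebra ℝ K] in
theorem y_mem_levi (j : zeroSet A) : y j ∈ levi K A x y z :=
  Submodule.mem_sup_left (Submodule.mem_sup_left (Submodule.subset_span ⟨j, rfl⟩))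

omit H hJ [Algebra ℝ K] in
theorem z_mem_levi (i : I) : z i ∈ levi K A x y z :=
  Submodule.mem_sup_left (Submodule.mem_sup_right (Submodule.subset_span ⟨i, rfl⟩))

omit H hJ [Algebra ℝ K] in
theorem levi_le {S : Submodule K L} (hx : ∀ j : zeroSet A, x j ∈ S)
    (hy : ∀ j : zeroSet A, y j ∈ S) (hz : ∀ i, z i ∈ S) : levi K A x y z ≤ S := by
  refine sup_le (sup_le ?_ ?_) ?_ <;> rw [Submodule.span_le] <;> rintro _ ⟨j, rfl⟩
  exacts [hy j, hz j, hx j]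

/-- The bracket of `y i` with the positive part. -/
theorem y_lie_mem (i : I) {w : L} (hw : w ∈ freePart K A x) :
    ⁅y i, w⁆ ∈ levi K A x y z ⊔ freePart K A x := by
  by_cases hi : i ∈ zeroSet A
  · exact Submodule.mem_sup_right (y_lie_freePart H hJ ⟨i, hi⟩ hw)
  refine lie_mem_sup x _ _ (fun s hs w hw => levi_lie_freePart H hJ hs hw) ?_ hw
  -- As `i ∉ J`, `ad (y i)` commutes with each `ad (x j)`, `j ∈ J`, and so reaches the innermost `x
  -- k`, where it gives `-z i` or `0`. The `ad (x j)` then act on that, and `S` is stable under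
  -- them.
  let S : Submodule K L := Submodule.span K (Set.range z) ⊔
    Submodule.span K (Set.range fun j : zeroSet A => x j)
  have hSz : ∀ i, z i ∈ S := fun i => Submodule.mem_sup_left (Submodule.subset_span ⟨i, rfl⟩)
  have hSx : ∀ j : zeroSet A, x j ∈ S :=
    fun j => Submodule.mem_sup_right (Submodule.subset_span ⟨j, rfl⟩)
  have hS : ∀ (j : zeroSet A), S ≤ S.comap (LieAlgebra.ad K L (x j)) := by
    intro j
    refine sup_le ?_ ?_ <;> rw [Submodule.span_le] <;> rintro _ ⟨k, rfl⟩
    · change ⁅x j, z k⁆ ∈ S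
      rw [← lie_skew, H.he]
      exact neg_mem (S.smul_mem _ (hSx j))
    · change ⁅x j, x k⁆ ∈ S
      rw [H.ee _ _ (hJ j k)]
      exact zero_mem _
  have key : ∀ t : WIndex A, ⁅y i, mono x t⁆ ∈ S := by
    rintro ⟨s, k⟩
    induction s using Multiset.induction with
    | empty =>
      rw [mono_zero, ← lie_skew]
      refine neg_mem ?_
      by_cases hki : (k : I) = i
      · rw [hki, H.ef_same]
        exact hSz i
      · rw [H.ef_ne _ _ hki]
        exact zero_mem _
    | cons j s ih =>
      rw [mono_cons (fun j k => H.ee _ _ (hJ j k)), leibniz_lie, ← lie_skew (y i) (x j),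
        H.ef_ne j i fun h => hi (h ▸ j.2), neg_zero, zero_lie, zero_add]
      exact hS j ih
  intro t
  have hle : S ≤ levi K A x y z := sup_le (le_sup_right.trans le_sup_left) le_sup_right
  exact Submodule.mem_sup_left (hle (key t))

theorem x_lie_levi (i : I) {d : L} (hd : d ∈ levi K A x y z) :
    ⁅x i, d⁆ ∈ levi K A x y z ⊔ freePart K A x := by
  have hx : x i ∈ levi K A x y z ⊔ freePart K A x := by
    by_cases hi : i ∈ zeroSet A
    · exact Submodule.mem_sup_left (x_mem_levi ⟨i, hi⟩)
    · exact Submodule.mem_sup_right (mem_freePart x i hi)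
  suffices h : levi K A x y z ≤
      (levi K A x y z ⊔ freePart K A x).comap (LieAlgebra.ad K L (x i)) from h hd
  refine levi_le (fun j => ?_) (fun j => ?_) (fun j => ?_)
  · change ⁅x i, x j⁆ ∈ levi K A x y z ⊔ freePart K A x
    by_cases hi : i ∈ zeroSet A
    · rw [H.ee _ _ (hJ ⟨i, hi⟩ j)]
      exact zero_mem _
    · rw [← lie_skew]
      exact neg_mem (Submodule.mem_sup_right (x_lie_freePart H hJ j (mem_freePart x i hi)))
  · change ⁅x i, y j⁆ ∈ levi K A x y z ⊔ freePart K A x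
    by_cases hij : i = j
    · rw [← hij, H.ef_same]
      exact Submodule.mem_sup_left (z_mem_levi i)
    · rw [H.ef_ne _ _ hij]
      exact zero_mem _
  · change ⁅x i, z j⁆ ∈ levi K A x y z ⊔ freePart K A x
    rw [← lie_skew, H.he]
    exact neg_mem (Submodule.smul_mem _ _ hx)

omit H hJ [Algebra ℝ K] in
theorem levi_swap : levi K A y x (fun i => -z i) = levi K A x y z := by
  refine le_antisymm (levi_le y_mem_levi x_mem_levi fun i => neg_mem (z_mem_levi i))
    (levi_le y_mem_levi x_mem_levi fun i => ?_)
  rw [← neg_neg (z i)]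
  exact neg_mem (z_mem_levi (z := fun i => -z i) i)

omit H hJ [Algebra ℝ K] in
theorem total_swap : total K A y x (fun i => -z i) = total K A x y z := by
  rw [total, total, levi_swap, sup_comm, ← sup_assoc, sup_right_comm, sup_assoc, sup_comm,
    sup_right_comm]

/-- On the negative summand this is `y_lie_mem` with the roles of `x` and `y` exchanged. -/
theorem x_lie_total (i : I) {w : L} (hw : w ∈ total K A x y z) : ⁅x i, w⁆ ∈ total K A x y z := by
  obtain ⟨v, hv, p, hp, rfl⟩ := Submodule.mem_sup.1 hw
  obtain ⟨n, hn, d, hd, rfl⟩ := Submodule.mem_sup.1 hv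
  rw [lie_add, lie_add]
  refine add_mem (add_mem ?_ ?_) ?_
  · have := y_lie_mem H.swap hJ i hn
    rw [levi_swap, sup_comm] at this
    exact Submodule.mem_sup_left this
  · have := x_lie_levi H hJ i hd
    rw [total, sup_assoc]
    exact Submodule.mem_sup_right this
  · exact Submodule.mem_sup_right (x_lie_freePart H hJ i hp)

theorem z_lie_total (i : I) {w : L} (hw : w ∈ total K A x y z) : ⁅z i, w⁆ ∈ total K A x y z := by
  obtain ⟨v, hv, p, hp, rfl⟩ := Submodule.mem_sup.1 hw
  obtain ⟨n, hn, d, hd, rfl⟩ := Submodule.mem_sup.1 hv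
  rw [lie_add, lie_add]
  refine add_mem (add_mem ?_ ?_) ?_
  · have := neg_mem (z_lie_freePart H.swap hJ i hn)
    rw [neg_lie, neg_neg] at this
    exact Submodule.mem_sup_left (Submodule.mem_sup_left this)
  · refine Submodule.mem_sup_left (Submodule.mem_sup_right ?_)
    suffices h : levi K A x y z ≤ (levi K A x y z).comap (LieAlgebra.ad K L (z i)) from h hd
    refine levi_le (fun j => ?_) (fun j => ?_) (fun j => ?_)
    · change ⁅z i, x j⁆ ∈ levi K A x y z
      rw [H.he]
      exact Submodule.smul_mem _ _ (x_mem_levi j)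
    · change ⁅z i, y j⁆ ∈ levi K A x y z
      rw [H.hf]
      exact neg_mem (Submodule.smul_mem _ _ (y_mem_levi j))
    · change ⁅z i, z j⁆ ∈ levi K A x y z
      rw [H.hh]
      exact zero_mem _
  · exact Submodule.mem_sup_right (z_lie_freePart H hJ i hp)

omit H hJ [Algebra ℝ K] in
theorem x_mem_total (i : I) : x i ∈ total K A x y z := by
  by_cases hi : i ∈ zeroSet A
  · exact Submodule.mem_sup_left (Submodule.mem_sup_right (x_mem_levi ⟨i, hi⟩))
  · exact Submodule.mem_sup_right (mem_freePart x i hi)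

omit H in
/-- The negative part, the Levi part and the positive part span the Borcherds algebra. -/
theorem total_eq_top : total K A (e K A) (f K A) (h K A) = ⊤ := by
  have H := isChevalley K A
  rw [eq_top_iff]
  rintro w -
  refine mem_of_stable _ x_mem_total (fun i => ?_)
    (fun i => Submodule.mem_sup_left (Submodule.mem_sup_right (z_mem_levi i)))
    (fun i v hv => x_lie_total H hJ i hv) (fun i v hv => ?_)
    (fun i v hv => z_lie_total H hJ i hv) w
  · rw [← total_swap]
    exact x_mem_total i
  · rw [← total_swap] at hv ⊢
    exact x_lie_total H.swap hJ i hv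

omit H hJ in
/-- If the matrix is zero, then the Borcherds algebra is spanned by its generators. -/
theorem span_generators_eq_top {B : Matrix I I ℝ} (hB : ∀ i j, B i j = 0) :
    Submodule.span K (Set.range (f K B)) ⊔ Submodule.span K (Set.range (h K B)) ⊔
      Submodule.span K (Set.range (e K B)) = ⊤ := by
  have H := isChevalley K B
  set S := Submodule.span K (Set.range (f K B)) ⊔ Submodule.span K (Set.range (h K B)) ⊔
      Submodule.span K (Set.range (e K B)) with hS
  have he : ∀ i, e K B i ∈ S := fun i => Submodule.mem_sup_right (Submodule.subset_span ⟨i, rfl⟩)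
  have hf : ∀ i, f K B i ∈ S :=
    fun i => Submodule.mem_sup_left (Submodule.mem_sup_left (Submodule.subset_span ⟨i, rfl⟩))
  have hh : ∀ i, h K B i ∈ S :=
    fun i => Submodule.mem_sup_left (Submodule.mem_sup_right (Submodule.subset_span ⟨i, rfl⟩))
  have hle : ∀ d : BorcherdsAlgebra K B, (∀ j, ⁅d, e K B j⁆ ∈ S) → (∀ j, ⁅d, f K B j⁆ ∈ S) →
      (∀ j, ⁅d, h K B j⁆ ∈ S) → ∀ w ∈ S, ⁅d, w⁆ ∈ S := by
    intro d h1 h2 h3 w hw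
    suffices h : S ≤ S.comap (LieAlgebra.ad K _ d) from h hw
    refine sup_le (sup_le ?_ ?_) ?_ <;> rw [Submodule.span_le] <;> rintro _ ⟨j, rfl⟩
    exacts [h2 j, h3 j, h1 j]
  have hef : ∀ i j, ⁅e K B i, f K B j⁆ ∈ S := by
    intro i j
    by_cases hij : i = j
    · rw [hij, H.ef_same]; exact hh j
    · rw [H.ef_ne i j hij]; exact zero_mem _
  rw [eq_top_iff]
  rintro w -
  refine mem_of_stable S he hf hh (fun i => hle _ (fun j => ?_) (hef i) (fun j => ?_))
    (fun i => hle _ (fun j => ?_) (fun j => ?_) (fun j => ?_))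
    (fun i => hle _ (fun j => ?_) (fun j => ?_) (fun j => ?_)) w
  · rw [H.ee i j (hB i j)]; exact zero_mem _
  · rw [← lie_skew, H.he]; exact neg_mem (S.smul_mem _ (he i))
  · rw [← lie_skew]; exact neg_mem (hef j i)
  · rw [H.ff i j (hB i j)]; exact zero_mem _
  · rw [← lie_skew, H.hf, neg_neg]; exact S.smul_mem _ (hf i)
  · rw [H.he]; exact S.smul_mem _ (he j)
  · rw [H.hf]; exact neg_mem (S.smul_mem _ (hf j))
  · rw [H.hh]; exact zero_mem _

end Spanning

end

end BorcherdsAlg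

/-! ### Ordered data and multisets -/

namespace BorcherdsAlg

noncomputable section

section Index

variable {I : Type*} {A : Matrix I I ℝ} [LinearOrder (zeroSet A)]

/-- The list with `ℓ k` repetitions of `j k`. -/
def UIndex.list (t : UIndex A) : List (zeroSet A) :=
  (List.ofFn fun k => (t.j k, t.l k)).flatMap fun p => List.replicate p.2 p.1

/-- The unordered form of an index. -/
def UIndex.toWIndex (t : UIndex A) : WIndex A := (t.list, ⟨t.i, t.i_notMem⟩)

theorem UIndex.count_list (t : UIndex A) (a : zeroSet A) :
    t.list.count a = ∑ k, if t.j k = a then t.l k else 0 := by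
  rw [UIndex.list, List.count_flatMap, List.map_ofFn, List.sum_ofFn]
  refine Finset.sum_congr rfl fun k _ => ?_
  simp [List.count_replicate]

theorem UIndex.count_list_j (t : UIndex A) (k : Fin t.n) : t.list.count (t.j k) = t.l k := by
  rw [t.count_list, Finset.sum_eq_single k]
  · simp
  · intro m _ hm
    rw [if_neg fun h => hm (t.j_strictMono.injective h)]
  · simp

theorem UIndex.mem_list (t : UIndex A) (a : zeroSet A) : a ∈ t.list ↔ a ∈ Set.range t.j := by
  constructor
  · intro ha
    by_contra hn
    have h0 : t.list.count a = 0 := by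
      rw [t.count_list]
      exact Finset.sum_eq_zero fun k _ => if_neg fun h => hn ⟨k, h⟩
    exact List.count_eq_zero.1 h0 ha
  · rintro ⟨k, rfl⟩
    rw [← List.count_pos_iff, t.count_list_j]
    exact t.l_pos k

/-- As every `ℓ k` is positive, the support of the multiset is exactly the set of the `j k`. A
strictly increasing enumeration is determined by its range, and the `ℓ k` are the multiplicities. -/
theorem UIndex.toWIndex_injective : Function.Injective (UIndex.toWIndex (A := A)) := by
  intro t t' h
  have hl : (t.list : Multiset (zeroSet A)) = t'.list := congrArg Prod.fst h
  have hi : t.i = t'.i := congrArg (fun s : WIndex A => (s.2 : I)) h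
  have hr : Set.range t.j = Set.range t'.j := by
    ext a
    rw [← t.mem_list, ← t'.mem_list, ← Multiset.mem_coe, hl, Multiset.mem_coe]
  have hn : t.n = t'.n := by
    have h1 := Nat.card_range_of_injective t.j_strictMono.injective
    have h2 := Nat.card_range_of_injective t'.j_strictMono.injective
    rw [hr, h2] at h1
    simpa using h1.symm
  have hc := t.count_list_j
  have hc' := t'.count_list_j
  have hcount : ∀ a, t.list.count a = t'.list.count a := fun a => by
    rw [← Multiset.coe_count, hl, Multiset.coe_count]
  obtain ⟨n, j, hj, l, hl1, i, hi1⟩ := t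
  obtain ⟨n', j', hj', l', hl1', i', hi1'⟩ := t'
  dsimp only at hn hr hi hc hc'
  subst hn hi
  obtain rfl := (hj.range_inj hj').1 hr
  obtain rfl : l = l' := by
    ext k
    rw [← hc k, ← hc' k, hcount]
  rfl

/-- The preimage enumerates the support in increasing order and takes the multiplicities as
exponents. -/
theorem UIndex.toWIndex_surjective : Function.Surjective (UIndex.toWIndex (A := A)) := by
  rintro ⟨s, i⟩
  let t : UIndex A :=
    { n := s.toFinset.card
      j := s.toFinset.orderEmbOfFin rfl
      j_strictMono := (s.toFinset.orderEmbOfFin rfl).strictMono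
      l := fun k => s.count (s.toFinset.orderEmbOfFin rfl k)
      l_pos := fun k => Multiset.count_pos.2
        (Multiset.mem_toFinset.1 (s.toFinset.orderEmbOfFin_mem rfl k))
      i := i
      i_notMem := i.2 }
  refine ⟨t, Prod.ext ?_ rfl⟩
  change (t.list : Multiset (zeroSet A)) = s
  ext a
  rw [Multiset.coe_count]
  by_cases ha : a ∈ s
  · obtain ⟨k, rfl⟩ : a ∈ Set.range t.j := by
      change a ∈ Set.range (s.toFinset.orderEmbOfFin rfl)
      simpa using ha
    rw [t.count_list_j]
  · rw [Multiset.count_eq_zero_of_notMem ha, List.count_eq_zero, t.mem_list]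
    rintro ⟨k, rfl⟩
    exact ha (Multiset.mem_toFinset.1 (s.toFinset.orderEmbOfFin_mem rfl k))

variable {K : Type*} [Field K] {L : Type*} [LieRing L] [LieAlgebra K L]

theorem prod_ad_pow_apply {J : Type*} (x : J → L) (m : List (J × ℕ)) (v : L) :
    (m.map fun p => LieAlgebra.ad K L (x p.1) ^ p.2).prod v =
      (m.flatMap fun p => List.replicate p.2 p.1).foldr (fun j w => ⁅x j, w⁆) v := by
  induction m with
  | nil => rfl
  | cons p m ih =>
    rw [List.map_cons, List.prod_cons, List.flatMap_cons, List.foldr_append, Module.End.mul_apply,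
      ih]
    generalize List.foldr _ v _ = w
    induction p.2 with
    | zero => rfl
    | succ n ihn =>
      rw [pow_succ', Module.End.mul_apply, ihn, List.replicate_succ, List.foldr_cons]
      rfl

theorem adMonomial_eq_mono {x : I → L} (hx : ∀ j k : zeroSet A, ⁅x j, x k⁆ = 0) (t : UIndex A) :
    adMonomial K x t = mono x t.toWIndex := by
  have := prod_ad_pow_apply (K := K) (fun j : zeroSet A => x j)
    (List.ofFn fun k => (t.j k, t.l k)) (x t.i)
  rw [List.map_ofFn] at this
  refine this.trans ?_
  exact (adMulti_coe (x := fun j : zeroSet A => x j) hx _ _).symm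

theorem range_adMonomial {x : I → L} (hx : ∀ j k : zeroSet A, ⁅x j, x k⁆ = 0) :
    Set.range (adMonomial K x : UIndex A → L) = Set.range (mono (A := A) x) := by
  rw [← UIndex.toWIndex_surjective.range_comp (mono x)]
  exact congrArg Set.range (funext (adMonomial_eq_mono hx))

end Index

/-! ### Free generating sets and internal direct sums -/

section Free

variable {K : Type*} [Field K] {L : Type*} [LieRing L] [LieAlgebra K L] {X : Type*}

variable (K X) in
theorem freeLie_of_injective : Function.Injective (FreeLieAlgebra.of K : X → _) := by
  intro a b hab
  have := congrArg (FreeLieAlgebra.lift K (FreeAlgebra.ι K)) hab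
  rw [FreeLieAlgebra.lift_of_apply, FreeLieAlgebra.lift_of_apply] at this
  exact FreeAlgebra.ι_injective this

/-- Distinctness of the monomials thus comes for free with freeness. -/
theorem injective_of_lift_injective {m : X → L}
    (hm : Function.Injective (FreeLieAlgebra.lift K m)) : Function.Injective m := by
  have : m = FreeLieAlgebra.lift K m ∘ FreeLieAlgebra.of K := by simp
  rw [this]
  exact hm.comp (freeLie_of_injective K X)

/-- The free Lie algebras on equivalent types are isomorphic. -/
def freeLieCongr {Y : Type*} (σ : X ≃ Y) : FreeLieAlgebra K X ≃ₗ⁅K⁆ FreeLieAlgebra K Y :=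
  { FreeLieAlgebra.lift K (FreeLieAlgebra.of K ∘ σ) with
    invFun := FreeLieAlgebra.lift K (FreeLieAlgebra.of K ∘ σ.symm)
    left_inv := fun w => by
      refine LieHom.congr_fun (f := (FreeLieAlgebra.lift K (FreeLieAlgebra.of K ∘ σ.symm)).comp
        (FreeLieAlgebra.lift K (FreeLieAlgebra.of K ∘ σ))) (g := LieHom.id) ?_ w
      ext x
      simp
    right_inv := fun w => by
      refine LieHom.congr_fun (f := (FreeLieAlgebra.lift K (FreeLieAlgebra.of K ∘ σ)).comp
        (FreeLieAlgebra.lift K (FreeLieAlgebra.of K ∘ σ.symm))) (g := LieHom.id) ?_ w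
      ext x
      simp }

theorem freeLieCongr_of {Y : Type*} (σ : X ≃ Y) (x : X) :
    freeLieCongr (K := K) σ (FreeLieAlgebra.of K x) = FreeLieAlgebra.of K (σ x) :=
  FreeLieAlgebra.lift_of_apply _ _

/-- Since `m` is itself injective, the free Lie algebra on the set of its values is the one on its
index type. -/
theorem isFreelyGeneratedBy_range {m : X → L}
    (hm : Function.Injective (FreeLieAlgebra.lift K m)) :
    IsFreelyGeneratedBy (FreeLieAlgebra.lift K m).range (Set.range m) := by
  let σ := Equiv.ofInjective m (injective_of_lift_injective hm)
  refine ⟨(freeLieCongr σ.symm).trans (LieEquiv.ofInjective _ hm), fun x => ?_⟩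
  rw [LieEquiv.trans_apply, freeLieCongr_of, LieEquiv.ofInjective_apply,
    FreeLieAlgebra.lift_of_apply]
  exact Equiv.apply_ofInjective_symm _ x

end Free

theorem isInternal_triple {K V : Type*} [Field K] [AddCommGroup V] [Module K V]
    {P Q R : Submodule K V}
    (hind : ∀ p ∈ P, ∀ q ∈ Q, ∀ r ∈ R, p + q + r = 0 → p = 0 ∧ q = 0 ∧ r = 0)
    (htop : P ⊔ Q ⊔ R = ⊤) : DirectSum.IsInternal ![P, Q, R] := by
  rw [DirectSum.isInternal_submodule_iff_iSupIndep_and_iSup_eq_top]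
  constructor
  · rw [iSupIndep_iff_finsetSum_eq_zero_imp_eq_zero]
    intro s v hv hs i hi
    -- A relation over a subset of the three indices is completed by zeros to a relation among all
    -- three.
    let w : Fin 3 → V := fun i => if i ∈ s then v i else 0
    have hw : ∀ i, w i ∈ ![P, Q, R] i := by
      intro i
      by_cases h : i ∈ s
      · simpa [w, h] using hv i h
      · simp [w, h]
    have hsum : w 0 + w 1 + w 2 = 0 := by
      rw [← Fin.sum_univ_three, ← hs]
      simp [w]
    obtain ⟨h0, h1, h2⟩ := hind _ (hw 0) _ (hw 1) _ (hw 2) hsum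
    have hwi : w i = 0 := by fin_cases i <;> assumption
    simpa [w, hi] using hwi
  · rw [eq_top_iff, ← htop]
    exact sup_le (sup_le (le_iSup ![P, Q, R] 0) (le_iSup ![P, Q, R] 1)) (le_iSup ![P, Q, R] 2)

/-! ### The Borcherds algebra of the zero block -/

section Block

variable {K : Type*} [Field K] [Algebra ℝ K] {I : Type*} {A : Matrix I I ℝ}

/-- The generators with index in `J` satisfy the relations of the Borcherds algebra of the block. -/
theorem isChevalley_zeroBlock : IsChevalley K (zeroBlock A) (fun j : zeroSet A => e K A j)
    (fun j => f K A j) (fun j => h K A j) where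
  hh _ _ := (isChevalley K A).hh _ _
  he _ _ := (isChevalley K A).he _ _
  hf _ _ := (isChevalley K A).hf _ _
  ef_same _ := (isChevalley K A).ef_same _
  ef_ne _ _ hij := (isChevalley K A).ef_ne _ _ fun h => hij (Subtype.ext h)
  ee i j hij := (isChevalley K A).ee i j hij
  ff i j hij := (isChevalley K A).ff i j hij

variable (hdiag : ∀ i, A i i ≤ 0)

variable (K) in
/-- The homomorphism from the Borcherds algebra of the block. -/
def blockHom : BorcherdsAlgebra K (zeroBlock A) →ₗ⁅K⁆ BorcherdsAlgebra K A :=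
  lift (fun j => hdiag j) isChevalley_zeroBlock

theorem blockHom_e (j : zeroSet A) : blockHom K hdiag (e K (zeroBlock A) j) = e K A j :=
  lift_e _ _ _

theorem blockHom_f (j : zeroSet A) : blockHom K hdiag (f K (zeroBlock A) j) = f K A j :=
  lift_f _ _ _

theorem blockHom_h (j : zeroSet A) : blockHom K hdiag (h K (zeroBlock A) j) = h K A j :=
  lift_h _ _ _

theorem exists_combination (hJ : ∀ j k : zeroSet A, A j k = 0)
    (w : BorcherdsAlgebra K (zeroBlock A)) : ∃ a c b : zeroSet A →₀ K,
      w = Finsupp.linearCombination K (f K (zeroBlock A)) a +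
        Finsupp.linearCombination K (h K (zeroBlock A)) c +
        Finsupp.linearCombination K (e K (zeroBlock A)) b := by
  have hw : w ∈ (⊤ : Submodule K (BorcherdsAlgebra K (zeroBlock A))) := trivial
  rw [← span_generators_eq_top (K := K) (B := zeroBlock A) hJ] at hw
  obtain ⟨v, hv, p, hp, rfl⟩ := Submodule.mem_sup.1 hw
  obtain ⟨n, hn, d, hd, rfl⟩ := Submodule.mem_sup.1 hv
  rw [← Finsupp.range_linearCombination] at hn hd hp
  obtain ⟨a, rfl⟩ := hn
  obtain ⟨c, rfl⟩ := hd
  obtain ⟨b, rfl⟩ := hp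
  exact ⟨a, c, b, rfl⟩

theorem exists_combination_levi {w : BorcherdsAlgebra K A}
    (hw : w ∈ levi K A (e K A) (f K A) (h K A)) :
    ∃ (a : zeroSet A →₀ K) (c : I →₀ K) (b : zeroSet A →₀ K),
      w = Finsupp.linearCombination K (fun j : zeroSet A => f K A j) a +
        Finsupp.linearCombination K (h K A) c +
        Finsupp.linearCombination K (fun j : zeroSet A => e K A j) b := by
  obtain ⟨v, hv, p, hp, rfl⟩ := Submodule.mem_sup.1 hw
  obtain ⟨n, hn, d, hd, rfl⟩ := Submodule.mem_sup.1 hv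
  rw [← Finsupp.range_linearCombination] at hn hd hp
  obtain ⟨a, rfl⟩ := hn
  obtain ⟨c, rfl⟩ := hd
  obtain ⟨b, rfl⟩ := hp
  exact ⟨a, c, b, rfl⟩

/-- The block is the zero matrix, so its algebra is spanned by its generators. Their images are
linearly independent by `combination_eq_zero`. -/
theorem blockHom_injective (hA : ∀ i j, A i j = A j i)
    (hz : ∀ i j, A i j = 0 → i ∈ zeroSet A ∧ j ∈ zeroSet A) (hJ : ∀ j k : zeroSet A, A j k = 0) :
    Function.Injective (blockHom K hdiag) := by
  rw [injective_iff_map_eq_zero]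
  intro w hw
  obtain ⟨a, c, b, rfl⟩ := exists_combination hJ w
  -- The Cartan coefficients are transported from `J` to `I`, because `combination` admits every `h
  -- i`.
  have : combination (A := A) 0 a (c.mapDomain Subtype.val) b 0 = 0 := by
    rw [← hw, combination, Finsupp.linearCombination_mapDomain]
    simp only [map_add, map_linearCombination, map_zero, zero_add, add_zero]
    simp only [blockHom_e, blockHom_f, blockHom_h, Function.comp_def]
  obtain ⟨-, rfl, hc, rfl, -⟩ := combination_eq_zero hdiag hA hz hJ this
  rw [Finsupp.mapDomain_injective Subtype.val_injective (hc.trans Finsupp.mapDomain_zero.symm)]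
  simp

theorem blockHom_range_sup_cartan (hJ : ∀ j k : zeroSet A, A j k = 0) :
    (blockHom K hdiag).range.toSubmodule ⊔ cartan K A = levi K A (e K A) (f K A) (h K A) := by
  apply le_antisymm
  · refine sup_le ?_ ?_
    · rintro _ ⟨w, rfl⟩
      have hle : (⊤ : Submodule K (BorcherdsAlgebra K (zeroBlock A))) ≤
          (levi K A (e K A) (f K A) (h K A)).comap (blockHom K hdiag).toLinearMap := by
        rw [← span_generators_eq_top (K := K) (B := zeroBlock A) hJ]
        refine sup_le (sup_le ?_ ?_) ?_ <;> rw [Submodule.span_le] <;> rintro _ ⟨j, rfl⟩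
        · change blockHom K hdiag (f K (zeroBlock A) j) ∈ levi K A (e K A) (f K A) (h K A)
          rw [blockHom_f]
          exact y_mem_levi j
        · change blockHom K hdiag (h K (zeroBlock A) j) ∈ levi K A (e K A) (f K A) (h K A)
          rw [blockHom_h]
          exact z_mem_levi (j : I)
        · change blockHom K hdiag (e K (zeroBlock A) j) ∈ levi K A (e K A) (f K A) (h K A)
          rw [blockHom_e]
          exact x_mem_levi j
      exact hle trivial
    · rw [cartan, Submodule.span_le]
      rintro _ ⟨i, rfl⟩
      exact z_mem_levi i
  · refine levi_le (fun j => ?_) (fun j => ?_) fun i => ?_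
    · exact Submodule.mem_sup_left ⟨e K _ j, blockHom_e hdiag j⟩
    · exact Submodule.mem_sup_left ⟨f K _ j, blockHom_f hdiag j⟩
    · exact Submodule.mem_sup_right (Submodule.subset_span ⟨i, rfl⟩)

end Block

end

end BorcherdsAlg

/-! ### The theorem -/

open BorcherdsAlg in
theorem theorem3p3 {K : Type*} [Field K] [Algebra ℝ K] {I : Type*} [Countable I]
    (A : Matrix I I ℝ) (hA : IsSymmetrizedBorcherdsCartan A) (hdiag : ∀ i, A i i ≤ 0)
    (hzero : ∀ i j, A i j = 0 ↔ i ∈ BorcherdsAlg.zeroSet A ∧ j ∈ BorcherdsAlg.zeroSet A)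
    [LinearOrder (BorcherdsAlg.zeroSet A)] :
    Function.Injective (BorcherdsAlg.adMonomial K (BorcherdsAlg.e K A) :
        BorcherdsAlg.UIndex A → BorcherdsAlgebra K A) ∧
    Function.Injective (BorcherdsAlg.adMonomial K (BorcherdsAlg.f K A) :
        BorcherdsAlg.UIndex A → BorcherdsAlgebra K A) ∧
    ∃ uPlus uMinus : LieSubalgebra K (BorcherdsAlgebra K A),
      BorcherdsAlg.IsFreelyGeneratedBy uPlus (BorcherdsAlg.UPlus K A) ∧
      BorcherdsAlg.IsFreelyGeneratedBy uMinus (BorcherdsAlg.UMinus K A) ∧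
      ∃ ι : BorcherdsAlgebra K (BorcherdsAlg.zeroBlock A) →ₗ⁅K⁆ BorcherdsAlgebra K A,
        (∀ j, ι (BorcherdsAlg.e K (BorcherdsAlg.zeroBlock A) j) = BorcherdsAlg.e K A j) ∧
        (∀ j, ι (BorcherdsAlg.f K (BorcherdsAlg.zeroBlock A) j) = BorcherdsAlg.f K A j) ∧
        (∀ j, ι (BorcherdsAlg.h K (BorcherdsAlg.zeroBlock A) j) = BorcherdsAlg.h K A j) ∧
        Function.Injective ι ∧
        DirectSum.IsInternal
          ![uMinus.toSubmodule,
            ι.range.toSubmodule ⊔ BorcherdsAlg.cartan K A,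
            uPlus.toSubmodule] := by
  have hsymm := hA.symm
  have hz : ∀ i j, A i j = 0 → i ∈ zeroSet A ∧ j ∈ zeroSet A := fun i j => (hzero i j).1
  have hJ : ∀ j k : zeroSet A, A j k = 0 := fun j k => (hzero j k).2 ⟨j.2, k.2⟩
  have hee : ∀ j k : zeroSet A, ⁅e K A j, e K A k⁆ = 0 :=
    fun j k => (isChevalley K A).ee j k (hJ j k)
  have hff : ∀ j k : zeroSet A, ⁅f K A j, f K A k⁆ = 0 :=
    fun j k => (isChevalley K A).ff j k (hJ j k)
  have hpos : Function.Injective (posHom K A) := by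
    rw [injective_iff_map_eq_zero]
    intro y hy
    exact (combination_eq_zero hdiag hsymm hz hJ (x := 0) (a := 0) (b := 0) (c := 0)
      (by simp [combination, hy])).2.2.2.2
  have hneg : Function.Injective (negHom K A) := by
    rw [injective_iff_map_eq_zero]
    intro x hx
    exact (combination_eq_zero hdiag hsymm hz hJ (y := 0) (a := 0) (b := 0) (c := 0)
      (by simp [combination, hx])).1
  refine ⟨?_, ?_, (posHom K A).range, (negHom K A).range, ?_, ?_, blockHom K hdiag,
    blockHom_e hdiag, blockHom_f hdiag, blockHom_h hdiag,
    blockHom_injective hdiag hsymm hz hJ, ?_⟩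
  · rw [show adMonomial K (e K A) = _ from funext (adMonomial_eq_mono hee)]
    exact (injective_of_lift_injective hpos).comp UIndex.toWIndex_injective
  · rw [show adMonomial K (f K A) = _ from funext (adMonomial_eq_mono hff)]
    exact (injective_of_lift_injective hneg).comp UIndex.toWIndex_injective
  · rw [UPlus, range_adMonomial hee]
    exact isFreelyGeneratedBy_range hpos
  · rw [UMinus, range_adMonomial hff]
    exact isFreelyGeneratedBy_range hneg
  · rw [blockHom_range_sup_cartan hdiag hJ]
    -- The ranges of `negHom` and `posHom` are by definition the two `freePart` summands of `total`.
    refine isInternal_triple ?_ (total_eq_top hJ)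
    rintro _ ⟨x, rfl⟩ q hq _ ⟨y, rfl⟩ hs
    obtain ⟨a, c, b, rfl⟩ := exists_combination_levi hq
    obtain ⟨rfl, rfl, rfl, rfl, rfl⟩ := combination_eq_zero hdiag hsymm hz hJ (c := c) hs
    exact ⟨map_zero _, by simp, map_zero _⟩
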